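/- Let $U\subset\mathbb R^2$ be a nonempty bounded domain (connected open set) with $C^{2,\alpha}$ boundary for some $0<\alpha\le 1$, let $\Omega=\mathbb R^2\setminus\bar U$, and for $R>0$ let $B_R$ be the open disc of radius $R$ centred at the origin. There exist constants $\lambda_0\in(0,1)$ and $C>0$, depending only on $U$, with the following property. Let $0<\lambda\le\lambda_0$, let $(R_k)_{k\in\mathbb N}$ be a real sequence with $R_k\to+\infty$, and put $\Omega_k=\Omega\cap B_{R_k}$. Then there is $k_0$ such that for every $k\ge k_0$ and every weak solution $(\mathbf w_k,p_k)\in W^{1,2}(\Omega_k)^2\times L^2(\Omega_k)$ of $$ \begin{cases} -\Delta\mathbf w_k+(\mathbf w_k\cdot\nabla)\mathbf w_k+\nabla p_k=0 & \text{in }\Omega_k,\\ \nabla\cdot\mathbf w_k=0 & \text{in }\Omega_k,\\ \mathbf w_k=0 & \text{on }\partial\Omega,\\ \mathbf w_k=\lambda\mathbf e_1 & \text{for }|z|=R_k, \end{cases} \qquad \mathbf e_1=(1,0), $$ the Dirichlet integral satisfies $$ D_k=\int_{\Omega_k}|\nabla\mathbf w_k|^2\le\frac{C\lambda^2}{|\ln\lambda|}.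 $$ Here the first equation is understood in the sense of distributions (tested with functions in $C_c^\infty(\Omega_k)$), the second almost everywhere, and the boundary conditions in the sense of $W^{1,2}$: $\mathbf w_k-\mathbf a\in W^{1,2}_0(\Omega_k)^2$ for some smooth field $\mathbf a$ on $\mathbb R^2$ that equals $0$ near $\partial\Omega$ and $\lambda\mathbf e_1$ near the circle $|z|=R_k$. -/

import Mathlib

open MeasureTheory Filter Topology
open scoped ContDiff NNReal

/-- The Euclidean plane. -/
abbrev Plane : Type := EuclideanSpace ℝ (Fin 2)

/-- The classical partial derivative `∂ⱼ φ` of a scalar function on the plane. -/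
noncomputable def partialD (j : Fin 2) (φ : Plane → ℝ) (z : Plane) : ℝ :=
  fderiv ℝ φ z (EuclideanSpace.single j (1 : ℝ))

/-- `φ ∈ C_c^∞(D)`: smooth with compact support contained in `D`. -/
structure IsTestFunction (D : Set Plane) (φ : Plane → ℝ) : Prop where
  smooth : ContDiff ℝ ∞ φ
  compact : HasCompactSupport φ
  support_subset : tsupport φ ⊆ D

/-- `f ∈ W^{1,2}(D)` (`D` open), with weak partial derivatives `∂ⱼ f = g j`. -/
structure IsW12 (D : Set Plane) (f : Plane → ℝ) (g : Fin 2 → Plane → ℝ) : Prop where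
  memLp : MemLp f 2 (volume.restrict D)
  memLp_grad : ∀ j, MemLp (g j) 2 (volume.restrict D)
  weak_partial : ∀ j, ∀ φ : Plane → ℝ, IsTestFunction D φ →
    ∫ z in D, f z * partialD j φ z = - ∫ z in D, g j z * φ z

/-- `f ∈ W^{1,2}_0(D)`, with weak partial derivatives `g j`: the function `f` belongs to the
closure of `C_c^∞(D)` in `W^{1,2}(D)`. -/
structure IsW12Zero (D : Set Plane) (f : Plane → ℝ) (g : Fin 2 → Plane → ℝ) : Prop
    extends IsW12 D f g where
  approx : ∃ φ : ℕ → Plane → ℝ, (∀ n, IsTestFunction D (φ n)) ∧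
    Tendsto (fun n => eLpNorm (fun z => φ n z - f z) 2 (volume.restrict D)) atTop (𝓝 0) ∧
    ∀ j, Tendsto (fun n => eLpNorm (fun z => partialD j (φ n) z - g j z) 2 (volume.restrict D))
      atTop (𝓝 0)

/-- The open set `U` has `C^{2,α}` boundary: near each boundary point, in suitable Cartesian
coordinates centred there, `U` is the region strictly below the graph of a function `g` of class
`C^{2,α}`. (A function of this class on a neighbourhood of `0` agrees near `0` with a function on
`ℝ` whose second derivative is globally `α`-Hölder.) -/
def HasC2HolderBoundary (α : ℝ≥0) (U : Set Plane) : Prop :=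
  ∀ x ∈ frontier U, ∃ (L : Plane ≃ₗᵢ[ℝ] Plane) (g : ℝ → ℝ) (r : ℝ), 0 < r ∧
    ContDiff ℝ 2 g ∧ (∃ K : ℝ≥0, HolderWith K α (iteratedDeriv 2 g)) ∧
    ∀ y ∈ Metric.ball x r, y ∈ U ↔ L (y - x) 1 < g (L (y - x) 0)

/-- The exterior domain `Ω = ℝ² \ closure U` of the obstacle `U`. -/
def exteriorDomain (U : Set Plane) : Set Plane := (closure U)ᶜ

/-- The truncated ("invading") domain `Ω ∩ B_R`. -/
def invadingDomain (U : Set Plane) (R : ℝ) : Set Plane :=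
  exteriorDomain U ∩ Metric.ball 0 R

/-- `(w, p) ∈ W^{1,2} × L²` is a weak solution on `Ω ∩ B_R` of the stationary Navier-Stokes system
`-Δw + (w·∇)w + ∇p = 0`, `div w = 0`, `w = 0` on `∂Ω`, `w = lam e₁` for `|z| = R`.
Here `G z i j = ∂ⱼ wᵢ (z)` is the weak gradient of `w` (unique almost everywhere). -/
structure IsInvadingSolution (U : Set Plane) (R lam : ℝ)
    (w : Plane → Plane) (G : Plane → Matrix (Fin 2) (Fin 2) ℝ) (p : Plane → ℝ) : Prop where
  velocity : ∀ i, IsW12 (invadingDomain U R) (fun z => w z i) (fun j z => G z i j)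
  pressure : MemLp p 2 (volume.restrict (invadingDomain U R))
  /-- The momentum equation, tested in each component `i`. -/
  momentum : ∀ i, ∀ φ : Plane → ℝ, IsTestFunction (invadingDomain U R) φ →
    ∫ z in invadingDomain U R,
      ((∑ j, G z i j * partialD j φ z) + (∑ j, w z j * G z i j) * φ z
        - p z * partialD i φ z) = 0
  divergence_free : ∀ᵐ z ∂(volume.restrict (invadingDomain U R)), ∑ i, G z i i = 0
  /-- The boundary conditions, in the `W^{1,2}` sense: `w` differs by an element of
  `W^{1,2}_0(Ω ∩ B_R)` from a smooth field `a` that equals `0` near `∂Ω` and `lam e₁` near the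
  circle `|z| = R`. (This does not depend on the choice of `a`.) -/
  boundary : ∃ a : Plane → Plane, ContDiff ℝ ∞ a ∧
    (∀ᶠ z in 𝓝ˢ (frontier (exteriorDomain U)), a z = 0) ∧
    (∀ᶠ z in 𝓝ˢ (Metric.sphere (0 : Plane) R), a z = EuclideanSpace.single 0 lam) ∧
    ∀ i, IsW12Zero (invadingDomain U R) (fun z => w z i - a z i)
      (fun j z => G z i j - partialD j (fun y => a y i) z)

/-- The Dirichlet integral `∫_D |∇w|²`, where `G` is the gradient of `w`. -/
noncomputable def dirichletIntegral (D : Set Plane) (G : Plane → Matrix (Fin 2) (Fin 2) ℝ) : ℝ :=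
  ∫ z in D, ∑ i, ∑ j, G z i j ^ 2

/-! ### Limits of integrals of products -/

section Products

variable {X : Type*} [MeasurableSpace X] {μ : Measure X}

/-! The proof is an energy estimate for `v = w - A`, where `A` is a solenoidal extension of the
boundary values with small Dirichlet integral. `A` is the rotated gradient of `lam (z₁ - c₁) q(log
(1 + |z - c|²))` with `c ∈ U`: it vanishes near the closure of `U` and equals `lam e₁` where `1 + |z
- c|² > T`. Since the cut-off `q` acts on a logarithmic scale of length `b = log T - log (1 + M²)`,
`|∇A|²` is at most a constant times `(lam / b)² / (1 + |z - c|²)`, and integration in polar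
coordinates gives `∫ |∇A|² ≲ lam² log T / b²` (`IsCutoffField.integral_sq_partialD_le`). When `log
T` and `b` are both comparable to `|log lam|`, this is of order `lam² / |log lam|`.

Testing the momentum equation with `v` removes the pressure, because `v` is solenoidal, and the term
`(w·∇v)·v`, by skew-symmetry. What remains is `∫ ∇w : ∇v + ∫ (w·∇A)·v = 0` (`energy_identity`). The
integrand of the second term lives where `1 + |z - c|² ≤ T`, and there `|A|` and `|∇A|` are
`O(lam)`. A Hardy inequality, available because `v` vanishes on `∂Ω` and `U` contains a disc about
`c`, bounds `∫ |v|²` over that region by a multiple of `T² ∫ |∇v|²`. With `T = lam^(-1/4)` the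
product `lam T² = lam^(1/2)` is small, so the term is absorbed and `∫ |∇w|² ≲ ∫ |∇A|²`
(`energy_estimate`). The polynomial loss `T²` is harmless since only `log T` enters the final bound.
-/

theorem tendsto_integral_mul_of_tendsto_eLpNorm {f g : ℕ → X → ℝ} {f' g' : X → ℝ}
    (hf : ∀ n, MemLp (f n) 2 μ) (hg : ∀ n, MemLp (g n) 2 μ) (hf' : MemLp f' 2 μ)
    (hg' : MemLp g' 2 μ)
    (hff : Tendsto (fun n => eLpNorm (fun x => f n x - f' x) 2 μ) atTop (𝓝 0))
    (hgg : Tendsto (fun n => eLpNorm (fun x => g n x - g' x) 2 μ) atTop (𝓝 0)) :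
    Tendsto (fun n => ∫ x, f n x * g n x ∂μ) atTop (𝓝 (∫ x, f' x * g' x ∂μ)) := by
  have key : ∀ {u v : X → ℝ} (hu : MemLp u 2 μ) (hv : MemLp v 2 μ),
      ∫ x, u x * v x ∂μ = inner ℝ (hv.toLp v) (hu.toLp u) := by
    intro u v hu hv
    rw [L2.inner_def]
    refine integral_congr_ae ?_
    filter_upwards [hu.coeFn_toLp, hv.coeFn_toLp] with x h1 h2
    rw [h1, h2]
    simp
  rw [key hf' hg']
  simp_rw [fun n => key (hf n) (hg n)]
  exact ((Lp.tendsto_Lp_iff_tendsto_eLpNorm'' g hg g' hg').2 hgg).inner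
    ((Lp.tendsto_Lp_iff_tendsto_eLpNorm'' f hf f' hf').2 hff)

theorem tendsto_integral_mul_of_tendsto_eLpNorm_left {f : ℕ → X → ℝ} {f' g : X → ℝ}
    (hf : ∀ n, MemLp (f n) 2 μ) (hf' : MemLp f' 2 μ) (hg : MemLp g 2 μ)
    (hff : Tendsto (fun n => eLpNorm (fun x => f n x - f' x) 2 μ) atTop (𝓝 0)) :
    Tendsto (fun n => ∫ x, g x * f n x ∂μ) atTop (𝓝 (∫ x, g x * f' x ∂μ)) := by
  refine tendsto_integral_mul_of_tendsto_eLpNorm (fun _ => hg) hf hg hf' ?_ hff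
  simp

theorem holderTriple_four_four_two : ENNReal.HolderTriple 4 4 2 := by
  refine ⟨?_⟩
  rw [← two_mul, show (4 : ENNReal) = 2 * 2 by norm_num,
    ENNReal.mul_inv (by simp) (by simp), ← mul_assoc, ENNReal.mul_inv_cancel (by simp) (by simp),
    one_mul]

/-- A trilinear expression `∫ w gₙ φₙ` vanishes in the limit if `w ∈ L⁴`, the `φₙ` are bounded in
`L⁴` and `gₙ → 0` in `L²`. -/
theorem tendsto_integral_mul_mul_zero {w : X → ℝ} {g φ : ℕ → X → ℝ} (hw : MemLp w 4 μ)
    (hg : ∀ n, MemLp (g n) 2 μ) (hφ : ∀ n, MemLp (φ n) 4 μ)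
    (hg0 : Tendsto (fun n => eLpNorm (g n) 2 μ) atTop (𝓝 0))
    {B : ENNReal} (hB : B ≠ ⊤) (hφB : ∀ n, eLpNorm (φ n) 4 μ ≤ B) :
    Tendsto (fun n => ∫ x, w x * g n x * φ n x ∂μ) atTop (𝓝 0) := by
  have := holderTriple_four_four_two
  have hC : eLpNorm w 4 μ * B ≠ ⊤ := ENNReal.mul_ne_top hw.2.ne hB
  have hlim : Tendsto (fun n => ((eLpNorm w 4 μ * B) * eLpNorm (g n) 2 μ).toReal) atTop (𝓝 0) := by
    have h1 : Tendsto (fun n => (eLpNorm w 4 μ * B) * eLpNorm (g n) 2 μ) atTop (𝓝 0) := by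
      simpa using ENNReal.Tendsto.const_mul hg0 (Or.inr hC)
    exact (ENNReal.tendsto_toReal ENNReal.zero_ne_top).comp h1
  refine squeeze_zero_norm (fun n => ?_) hlim
  have h2 : eLpNorm (w • φ n) 2 μ ≤ eLpNorm w 4 μ * eLpNorm (φ n) 4 μ :=
    eLpNorm_smul_le_mul_eLpNorm (hφ n).1 hw.1
  have h3 : eLpNorm ((w • φ n) • g n) 1 μ ≤ eLpNorm (w • φ n) 2 μ * eLpNorm (g n) 2 μ :=
    eLpNorm_smul_le_mul_eLpNorm (hg n).1 (hw.1.smul (hφ n).1)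
  have h4 : eLpNorm ((w • φ n) • g n) 1 μ ≤ (eLpNorm w 4 μ * B) * eLpNorm (g n) 2 μ :=
    h3.trans (by gcongr; exact h2.trans (by gcongr; exact hφB n))
  calc ‖∫ x, w x * g n x * φ n x ∂μ‖
      ≤ (∫⁻ x, ENNReal.ofReal ‖w x * g n x * φ n x‖ ∂μ).toReal := norm_integral_le_lintegral_norm _
    _ = (eLpNorm ((w • φ n) • g n) 1 μ).toReal := by
        rw [eLpNorm_one_eq_lintegral_enorm]
        congr 1
        refine lintegral_congr fun x => ?_
        rw [ofReal_norm]
        congr 1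
        simp only [smul_eq_mul, Pi.mul_apply]
        ring
    _ ≤ _ := ENNReal.toReal_mono (ENNReal.mul_ne_top hC (hg n).2.ne) h4

theorem MeasureTheory.MemLp.integrable_mul_mul {w g φ : X → ℝ} (hw : MemLp w 4 μ)
    (hg : MemLp g 2 μ) (hφ : MemLp φ 4 μ) : Integrable (fun x => w x * g x * φ x) μ := by
  have := holderTriple_four_four_two
  have h : MemLp (w * φ) 2 μ := hφ.mul hw
  refine (h.integrable_mul hg).congr (Eventually.of_forall fun x => ?_)
  simp only [Pi.mul_apply]
  ring

/-- Lower semicontinuity of the `L^q` norm under `L^p` convergence. -/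
theorem eLpNorm_le_of_tendsto_eLpNorm {p q : ENNReal} (hp : p ≠ 0) {f : ℕ → X → ℝ} {f' : X → ℝ}
    (hf : ∀ n, AEStronglyMeasurable (f n) μ) (hf' : AEStronglyMeasurable f' μ)
    (hff : Tendsto (fun n => eLpNorm (fun x => f n x - f' x) p μ) atTop (𝓝 0))
    {B : ENNReal} (hB : ∀ n, eLpNorm (f n) q μ ≤ B) : eLpNorm f' q μ ≤ B := by
  obtain ⟨ns, -, hns⟩ := (tendstoInMeasure_of_tendsto_eLpNorm hp hf hf' hff).exists_seq_tendsto_ae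
  refine (Lp.eLpNorm_lim_le_liminf_eLpNorm (fun n => hf (ns n)) f' hns).trans ?_
  exact liminf_le_of_le (by isBoundedDefault) fun b hb => by
    obtain ⟨n, hn⟩ := hb.exists
    exact hn.trans (hB _)

theorem exists_eLpNorm_le_of_tendsto {f : ℕ → X → ℝ} {f' : X → ℝ} {p : ENNReal} (hp : 1 ≤ p)
    (hf : ∀ n, MemLp (f n) p μ) (hf' : MemLp f' p μ)
    (hff : Tendsto (fun n => eLpNorm (fun x => f n x - f' x) p μ) atTop (𝓝 0)) :
    ∃ B : ENNReal, B ≠ ⊤ ∧ ∀ n, eLpNorm (f n) p μ ≤ B := by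
  have : Fact (1 ≤ p) := ⟨hp⟩
  have h := (Lp.tendsto_Lp_iff_tendsto_eLpNorm'' f hf f' hf').2 hff
  obtain ⟨C, hC⟩ := (h.norm.bddAbove_range)
  refine ⟨ENNReal.ofReal C, ENNReal.ofReal_ne_top, fun n => ?_⟩
  have := hC ⟨n, rfl⟩
  simp only [Lp.norm_toLp] at this
  exact (ENNReal.le_ofReal_iff_toReal_le (hf n).2.ne (ENNReal.toReal_nonneg.trans this)).2 this

end Products

/-! ### Test functions -/

theorem IsTestFunction.differentiable {D : Set Plane} {φ : Plane → ℝ} (h : IsTestFunction D φ) :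
    Differentiable ℝ φ := h.smooth.differentiable (by simp)

theorem contDiff_partialD {φ : Plane → ℝ} (h : ContDiff ℝ ∞ φ) (j : Fin 2) :
    ContDiff ℝ ∞ (partialD j φ) :=
  (h.fderiv_right (m := ∞) (by simp)).clm_apply contDiff_const

theorem support_partialD_subset (φ : Plane → ℝ) (j : Fin 2) :
    Function.support (partialD j φ) ⊆ tsupport φ := by
  intro z hz
  by_contra hn
  exact hz (by simp [partialD, fderiv_of_notMem_tsupport ℝ hn])

theorem partialD_mul {f g : Plane → ℝ} {z : Plane} (hf : DifferentiableAt ℝ f z)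
    (hg : DifferentiableAt ℝ g z) (j : Fin 2) :
    partialD j (fun y => f y * g y) z = partialD j f z * g z + f z * partialD j g z := by
  simp only [partialD]
  rw [fderiv_fun_mul hf hg]
  simp
  ring

theorem partialD_sub {f g : Plane → ℝ} {z : Plane} (hf : DifferentiableAt ℝ f z)
    (hg : DifferentiableAt ℝ g z) (j : Fin 2) :
    partialD j (fun y => f y - g y) z = partialD j f z - partialD j g z := by
  simp only [partialD]
  rw [fderiv_fun_sub hf hg]
  simp

theorem partialD_congr {f g : Plane → ℝ} {z : Plane} (h : f =ᶠ[𝓝 z] g) (j : Fin 2) :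
    partialD j f z = partialD j g z := by
  simp only [partialD, h.fderiv_eq]

theorem integral_partialD_eq_zero {F : Plane → ℝ} (hF : ContDiff ℝ ∞ F) (hc : HasCompactSupport F)
    (j : Fin 2) : ∫ z, partialD j F z = 0 := by
  have hd : Continuous (partialD j F) := (contDiff_partialD hF j).continuous
  have hdc : HasCompactSupport (partialD j F) := hc.mono' (support_partialD_subset F j)
  -- Integration by parts against the constant function `1`.
  have h := integral_mul_fderiv_eq_neg_fderiv_mul_of_integrable (μ := (volume : Measure Plane))
    (f := fun _ : Plane => (1 : ℝ)) (g := F) (v := EuclideanSpace.single j 1)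
    (by simp) (by simpa using! hd.integrable_of_hasCompactSupport hdc)
    (by simpa using hF.continuous.integrable_of_hasCompactSupport hc)
    (by simp) (fun z _ => hF.differentiable (by simp) z)
  simpa [partialD] using h

theorem IsTestFunction.memLp {D : Set Plane} {φ : Plane → ℝ} (h : IsTestFunction D φ)
    (p : ENNReal) (μ : Measure Plane) [IsFiniteMeasureOnCompacts μ] : MemLp φ p μ :=
  h.smooth.continuous.memLp_of_hasCompactSupport h.compact

theorem IsTestFunction.memLp_partialD {D : Set Plane} {φ : Plane → ℝ} (h : IsTestFunction D φ)
    (j : Fin 2) (p : ENNReal) (μ : Measure Plane) [IsFiniteMeasureOnCompacts μ] :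
    MemLp (partialD j φ) p μ :=
  (contDiff_partialD h.smooth j).continuous.memLp_of_hasCompactSupport
    (h.compact.mono' (support_partialD_subset φ j))

theorem IsTestFunction.mul {D : Set Plane} {φ ψ : Plane → ℝ} (h : IsTestFunction D φ)
    (h' : ContDiff ℝ ∞ ψ) : IsTestFunction D (fun z => φ z * ψ z) :=
  ⟨h.smooth.mul h', h.compact.mul_right, (tsupport_mul_subset_left).trans h.support_subset⟩

theorem IsTestFunction.sub {D : Set Plane} {φ ψ : Plane → ℝ} (h : IsTestFunction D φ)
    (h' : IsTestFunction D ψ) : IsTestFunction D (fun z => φ z - ψ z) := by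
  refine ⟨h.smooth.sub h'.smooth, ?_, (tsupport_sub φ ψ).trans
    (Set.union_subset h.support_subset h'.support_subset)⟩
  exact h.compact.sub h'.compact

theorem norm_fderiv_le_sum_partialD (φ : Plane → ℝ) (z : Plane) :
    ‖fderiv ℝ φ z‖ ≤ ‖partialD 0 φ z‖ + ‖partialD 1 φ z‖ := by
  refine ContinuousLinearMap.opNorm_le_bound _
    (add_nonneg (norm_nonneg _) (norm_nonneg _)) fun x => ?_
  have hx : x = x 0 • EuclideanSpace.single (0 : Fin 2) (1 : ℝ)
      + x 1 • EuclideanSpace.single (1 : Fin 2) (1 : ℝ) := by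
    ext i; fin_cases i <;> simp
  have hn : ∀ i, ‖x i‖ ≤ ‖x‖ := fun i => PiLp.norm_apply_le x i
  conv_lhs => rw [hx]
  rw [map_add, map_smul, map_smul]
  refine (norm_add_le _ _).trans ?_
  rw [norm_smul, norm_smul]
  simp only [add_mul, partialD]
  rw [mul_comm ‖x 0‖, mul_comm ‖x 1‖]
  gcongr
  · exact hn 0
  · exact hn 1

theorem eLpNorm_fderiv_le_sum_partialD {φ : Plane → ℝ} (hφ : ContDiff ℝ ∞ φ)
    (μ : Measure Plane) : eLpNorm (fderiv ℝ φ) 2 μ ≤ ∑ j, eLpNorm (partialD j φ) 2 μ := by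
  have hm : ∀ j, AEStronglyMeasurable (fun z => ‖partialD j φ z‖) μ := fun j =>
    (contDiff_partialD hφ j).continuous.norm.aestronglyMeasurable
  calc eLpNorm (fderiv ℝ φ) 2 μ
      ≤ eLpNorm ((fun z => ‖partialD 0 φ z‖) + fun z => ‖partialD 1 φ z‖) 2 μ :=
        eLpNorm_mono_real fun z => norm_fderiv_le_sum_partialD φ z
    _ ≤ _ := by
        refine (eLpNorm_add_le (hm 0) (hm 1) (by norm_num)).trans ?_
        rw [Fin.sum_univ_two]
        exact (congrArg₂ (· + ·) (eLpNorm_norm _) (eLpNorm_norm _)).le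

/-- In dimension two the Gagliardo–Nirenberg–Sobolev inequality needs a gradient exponent below `2`.
The exponent `4/3` is the one whose Sobolev conjugate is `4`; on a bounded set, Hölder then trades
`L^{4/3}` for `L²`. -/
theorem eLpNorm_four_le_fderiv {D : Set Plane} (hD : Bornology.IsBounded D) {φ : Plane → ℝ}
    (hφ : IsTestFunction D φ) :
    eLpNorm φ 4 (volume.restrict D) ≤
      eLpNormLESNormFDerivOfLeConst ℝ (volume : Measure Plane) D (4 / 3 : ℝ≥0) 4 *
        eLpNorm (fderiv ℝ φ) ((4 / 3 : ℝ≥0) : ENNReal) (volume.restrict D) := by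
  have hsupp : Function.support φ ⊆ D := (subset_tsupport φ).trans hφ.support_subset
  have hsupp' : Function.support (fderiv ℝ φ) ⊆ D :=
    (support_fderiv_subset ℝ).trans hφ.support_subset
  have hp1 : (1 : ℝ≥0) ≤ 4 / 3 := by rw [← NNReal.coe_le_coe]; norm_num
  have hp2 : (4 / 3 : ℝ≥0) < Module.finrank ℝ Plane := by
    rw [finrank_euclideanSpace_fin, ← NNReal.coe_lt_coe]; norm_num
  have hp3 : (((4 / 3 : ℝ≥0)⁻¹ : ℝ≥0) : ℝ) - (Module.finrank ℝ Plane : ℝ)⁻¹ ≤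
      ((4 : ℝ≥0) : ℝ)⁻¹ := by
    rw [finrank_euclideanSpace_fin]; norm_num
  have h1 := eLpNorm_le_eLpNorm_fderiv_of_le (volume : Measure Plane) (u := φ) (s := D)
    (p := (4 / 3 : ℝ≥0)) (q := 4)
    (hφ.smooth.of_le (by simp)) hsupp hp1 hp2 hp3 hD
  have h4 : eLpNorm (fderiv ℝ φ) ((4 / 3 : ℝ≥0) : ENNReal) (volume.restrict D) =
      eLpNorm (fderiv ℝ φ) ((4 / 3 : ℝ≥0) : ENNReal) volume := by
    rw [← eLpNorm_norm (fderiv ℝ φ), ← eLpNorm_norm (fderiv ℝ φ)]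
    refine eLpNorm_restrict_eq_of_support_subset fun z hz => hsupp' ?_
    rw [Function.mem_support] at hz ⊢
    exact norm_ne_zero_iff.1 hz
  have h5 : (4 : ENNReal) = ((4 : ℝ≥0) : ENNReal) := by norm_num
  rw [eLpNorm_restrict_eq_of_support_subset hsupp, h4, h5]
  exact h1

/-- The Sobolev embedding `W^{1,2}_0(D) ⊆ L⁴(D)` on bounded plane domains, for test functions. -/
theorem exists_eLpNorm_four_le {D : Set Plane} (hD : Bornology.IsBounded D) :
    ∃ C : ENNReal, C ≠ ⊤ ∧ ∀ φ : Plane → ℝ, IsTestFunction D φ →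
      eLpNorm φ 4 (volume.restrict D) ≤ C * ∑ j, eLpNorm (partialD j φ) 2 (volume.restrict D) := by
  have hfin : volume D ≠ ⊤ := hD.measure_lt_top.ne
  have hexp : (0 : ℝ) ≤ 1 / ((4 / 3 : ℝ≥0) : ENNReal).toReal - 1 / (2 : ENNReal).toReal := by
    norm_num
  have hle : ((4 / 3 : ℝ≥0) : ENNReal) ≤ 2 := by
    rw [show (2 : ENNReal) = ((2 : ℝ≥0) : ENNReal) by simp, ENNReal.coe_le_coe,
      ← NNReal.coe_le_coe]
    norm_num
  refine ⟨_, ENNReal.mul_ne_top (ENNReal.coe_ne_top (r :=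
    eLpNormLESNormFDerivOfLeConst ℝ (volume : Measure Plane) D (4 / 3 : ℝ≥0) 4))
    (ENNReal.rpow_ne_top_of_nonneg hexp hfin), fun φ hφ => ?_⟩
  have h2 := eLpNorm_le_eLpNorm_mul_rpow_measure_univ (μ := volume.restrict D) hle
    (hφ.smooth.continuous_fderiv (by simp)).aestronglyMeasurable
  rw [Measure.restrict_apply_univ] at h2
  refine (eLpNorm_four_le_fderiv hD hφ).trans ?_
  rw [mul_assoc]
  gcongr
  refine h2.trans ?_
  rw [mul_comm]
  gcongr
  exact eLpNorm_fderiv_le_sum_partialD hφ.smooth _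

/-! ### A Hardy inequality for functions vanishing on a disc -/

/-- The squared distance, in coordinates. -/
def distSq (c z : Plane) : ℝ := (z 0 - c 0) ^ 2 + (z 1 - c 1) ^ 2

theorem distSq_eq (c z : Plane) : distSq c z = dist z c ^ 2 := by
  rw [EuclideanSpace.dist_eq, Real.sq_sqrt (by positivity)]
  simp [distSq, Fin.sum_univ_two, Real.dist_eq, sq_abs]

theorem distSq_nonneg (c z : Plane) : 0 ≤ distSq c z := by
  unfold distSq; positivity

theorem contDiff_coord (i : Fin 2) : ContDiff ℝ ∞ fun z : Plane => z i :=
  contDiff_piLp_apply (p := 2)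

theorem contDiff_distSq (c : Plane) : ContDiff ℝ ∞ (distSq c) := by
  have h := contDiff_coord
  unfold distSq
  exact (((h 0).sub contDiff_const).pow 2).add (((h 1).sub contDiff_const).pow 2)

theorem partialD_eq_of_hasDerivAt {F : Plane → ℝ} {z : Plane} (hF : DifferentiableAt ℝ F z)
    {j : Fin 2} {d : ℝ}
    (h : HasDerivAt (fun t : ℝ => F (z + t • EuclideanSpace.single j (1 : ℝ))) d 0) :
    partialD j F z = d := by
  have h1 : HasLineDerivAt ℝ F (fderiv ℝ F z (EuclideanSpace.single j (1 : ℝ))) z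
      (EuclideanSpace.single j (1 : ℝ)) := hF.hasFDerivAt.hasLineDerivAt _
  exact HasDerivAt.unique h1 h

theorem hasDerivAt_coord (z : Plane) (i j : Fin 2) :
    HasDerivAt (fun t : ℝ => (z + t • EuclideanSpace.single j (1 : ℝ)) i)
      (if i = j then 1 else 0) 0 := by
  have h : (fun t : ℝ => (z + t • EuclideanSpace.single j (1 : ℝ)) i) =
      fun t => z i + t * (if i = j then 1 else 0) := by
    ext t
    simp
  rw [h]
  simpa using ((hasDerivAt_id (0 : ℝ)).mul_const (if i = j then (1 : ℝ) else 0)).const_add (z i)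

theorem hasDerivAt_distSq (c z : Plane) (j : Fin 2) :
    HasDerivAt (fun t : ℝ => distSq c (z + t • EuclideanSpace.single j (1 : ℝ)))
      (2 * (z j - c j)) 0 := by
  have h := (((hasDerivAt_coord z 0 j).sub_const (c 0)).pow 2).add
    (((hasDerivAt_coord z 1 j).sub_const (c 1)).pow 2)
  unfold distSq
  convert! h using 1
  fin_cases j <;> simp

/-- The components of the vector field `-(z - c) / (|z - c|² + δ)²`. -/
noncomputable def hardyField (c : Plane) (δ : ℝ) (j : Fin 2) (z : Plane) : ℝ :=
  -(z j - c j) / (distSq c z + δ) ^ 2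

theorem contDiff_hardyField (c : Plane) {δ : ℝ} (hδ : 0 < δ) (j : Fin 2) :
    ContDiff ℝ ∞ (hardyField c δ j) := by
  refine ContDiff.div ((contDiff_coord j).sub contDiff_const).neg
    (((contDiff_distSq c).add contDiff_const).pow 2) fun z => ?_
  have := distSq_nonneg c z
  positivity

theorem partialD_hardyField (c : Plane) {δ : ℝ} (hδ : 0 < δ) (j : Fin 2) (z : Plane) :
    partialD j (hardyField c δ j) z =
      -1 / (distSq c z + δ) ^ 2 + 4 * (z j - c j) ^ 2 / (distSq c z + δ) ^ 3 := by
  have h0 := distSq_nonneg c z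
  have hP : (distSq c z + δ) ≠ 0 := by positivity
  refine partialD_eq_of_hasDerivAt ((contDiff_hardyField c hδ j).differentiable (by simp) z) ?_
  have h := ((hasDerivAt_coord z j j).sub_const (c j)).neg.div
    (((hasDerivAt_distSq c z j).add_const δ).pow 2) (by simpa using hP)
  unfold hardyField
  convert! h using 1
  simp only [zero_smul, add_zero, if_true]
  field_simp
  simp
  ring

/-- With `(x, y) = z - c` and `(a, b) = ∇f`, the right side is the divergence of `f²` times
`hardyField`. For `P = x² + y² + δ` the field alone has divergence `(2P - 4δ) / P³`, which is at
least `1 / P²` once `P ≥ 4δ`, that is, wherever `f` may be nonzero. Young's inequality spends half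
of this on the cross term, using `4δ (P - δ) ≤ P²`. -/
theorem hardy_pointwise {x y a b f δ : ℝ} (hδ : 0 < δ) (h : f = 0 ∨ 3 * δ ≤ x ^ 2 + y ^ 2) :
    2⁻¹ * (f ^ 2 / (x ^ 2 + y ^ 2 + δ) ^ 2) - 1 / (2 * δ) * (a ^ 2 + b ^ 2) ≤
      (2 * f * a * (-x / (x ^ 2 + y ^ 2 + δ) ^ 2) + f ^ 2 *
        (-1 / (x ^ 2 + y ^ 2 + δ) ^ 2 + 4 * x ^ 2 / (x ^ 2 + y ^ 2 + δ) ^ 3)) +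
      (2 * f * b * (-y / (x ^ 2 + y ^ 2 + δ) ^ 2) + f ^ 2 *
        (-1 / (x ^ 2 + y ^ 2 + δ) ^ 2 + 4 * y ^ 2 / (x ^ 2 + y ^ 2 + δ) ^ 3)) := by
  rcases h with rfl | h
  · have : 0 ≤ 1 / (2 * δ) * (a ^ 2 + b ^ 2) := by positivity
    simp
    simpa using this
  obtain ⟨P, hP⟩ : ∃ P, P = x ^ 2 + y ^ 2 + δ := ⟨_, rfl⟩
  have hP0 : 0 < P := by rw [hP]; positivity
  rw [← hP]
  have hs : x ^ 2 + y ^ 2 = P - δ := by linarith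
  have h4 : 4 * δ ≤ P := by linarith
  have e : (2 * f * a * (-x / P ^ 2) + f ^ 2 * (-1 / P ^ 2 + 4 * x ^ 2 / P ^ 3)) +
      (2 * f * b * (-y / P ^ 2) + f ^ 2 * (-1 / P ^ 2 + 4 * y ^ 2 / P ^ 3)) =
      (-2 * f * (a * x + b * y)) / P ^ 2 + f ^ 2 * (2 * P - 4 * δ) / P ^ 3 := by
    have : y ^ 2 = P - δ - x ^ 2 := by linarith
    field_simp
    rw [this]
    ring
  rw [e]
  have h1 : f ^ 2 / P ^ 2 ≤ f ^ 2 * (2 * P - 4 * δ) / P ^ 3 := by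
    rw [div_le_div_iff₀ (by positivity) (by positivity)]
    have : f ^ 2 * P ^ 2 * P ≤ f ^ 2 * P ^ 2 * (2 * P - 4 * δ) := by gcongr; linarith
    linarith
  have hcs : (a * x + b * y) ^ 2 ≤ (a ^ 2 + b ^ 2) * (x ^ 2 + y ^ 2) := by
    nlinarith [sq_nonneg (a * y - b * x)]
  have h2 : 2 * f * (a * x + b * y) / P ^ 2 ≤
      2⁻¹ * (f ^ 2 / P ^ 2) + 1 / (2 * δ) * (a ^ 2 + b ^ 2) := by
    have h3 : (P - δ) * (4 * δ) ≤ P ^ 2 := by nlinarith [sq_nonneg (P - 2 * δ)]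
    have h5 : 2 * (a * x + b * y) ^ 2 / P ^ 2 ≤ 1 / (2 * δ) * (a ^ 2 + b ^ 2) := by
      rw [div_mul_eq_mul_div, one_mul, div_le_div_iff₀ (by positivity) (by positivity)]
      rw [hs] at hcs
      have : 0 ≤ a ^ 2 + b ^ 2 := by positivity
      nlinarith [mul_le_mul_of_nonneg_left h3 this]
    have h6 : 2 * f * (a * x + b * y) / P ^ 2 ≤
        2⁻¹ * (f ^ 2 / P ^ 2) + 2 * (a * x + b * y) ^ 2 / P ^ 2 := by
      rw [← mul_div_assoc, ← add_div]
      gcongr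
      nlinarith [sq_nonneg (f - 2 * (a * x + b * y))]
    linarith
  have h7 : (-2 * f * (a * x + b * y)) / P ^ 2 = -(2 * f * (a * x + b * y) / P ^ 2) := by ring
  rw [h7]
  linarith

/-- A Hardy inequality for compactly supported functions vanishing on a disc. -/
theorem hardy_inequality {c : Plane} {ρ : ℝ} (hρ : 0 < ρ) {D : Set Plane} {φ : Plane → ℝ}
    (hφ : IsTestFunction D φ) (hD : ∀ z ∈ D, ρ ≤ dist z c) :
    ∫ z, φ z ^ 2 / (distSq c z + ρ ^ 2 / 3) ^ 2 ≤
      3 / ρ ^ 2 * ∫ z, (partialD 0 φ z ^ 2 + partialD 1 φ z ^ 2) := by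
  -- Now `3δ = ρ²` is exactly the threshold of `hardy_pointwise`, and `δ > 0` keeps the field smooth
  -- at `c`, so the divergence can be integrated over the whole plane.
  obtain ⟨δ, hδe⟩ : ∃ δ, δ = ρ ^ 2 / 3 := ⟨_, rfl⟩
  have hδ : 0 < δ := by rw [hδe]; positivity
  rw [← hδe]
  have hF : ∀ j, IsTestFunction D fun z => φ z * φ z * hardyField c δ j z := fun j =>
    (hφ.mul hφ.smooth).mul (contDiff_hardyField c hδ j)
  have hint : ∀ j, Integrable (partialD j fun z => φ z * φ z * hardyField c δ j z) := fun j =>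
    memLp_one_iff_integrable.1 ((hF j).memLp_partialD j 1 volume)
  have hzero : ∫ z, ((partialD 0 fun z => φ z * φ z * hardyField c δ 0 z) z +
      (partialD 1 fun z => φ z * φ z * hardyField c δ 1 z) z) = 0 := by
    rw [integral_add (hint 0) (hint 1), integral_partialD_eq_zero (hF 0).smooth (hF 0).compact,
      integral_partialD_eq_zero (hF 1).smooth (hF 1).compact, add_zero]
  have hd : ∀ j z, (partialD j fun z => φ z * φ z * hardyField c δ j z) z =
      2 * φ z * partialD j φ z * (-(z j - c j) / (distSq c z + δ) ^ 2) + φ z ^ 2 *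
        (-1 / (distSq c z + δ) ^ 2 + 4 * (z j - c j) ^ 2 / (distSq c z + δ) ^ 3) := by
    intro j z
    have h1 := hφ.differentiable z
    rw [partialD_mul (f := fun z => φ z * φ z) (h1.mul h1)
      ((contDiff_hardyField c hδ j).differentiable (by simp) z),
      partialD_mul h1 h1, partialD_hardyField c hδ]
    simp only [hardyField]
    ring
  have hi1 : Integrable fun z => φ z ^ 2 / (distSq c z + δ) ^ 2 := by
    have hne : ∀ z, (distSq c z + δ) ^ 2 ≠ 0 := fun z => by
      have := distSq_nonneg c z
      positivity
    have : IsTestFunction D fun z => φ z * (φ z / (distSq c z + δ) ^ 2) := hφ.mul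
      (hφ.smooth.div (((contDiff_distSq c).add contDiff_const).pow 2) hne)
    refine (memLp_one_iff_integrable.1 (this.memLp 1 volume)).congr
      (Eventually.of_forall fun z => ?_)
    simp only
    ring
  have hi2 : Integrable fun z => partialD 0 φ z ^ 2 + partialD 1 φ z ^ 2 :=
    (hφ.memLp_partialD 0 2 volume).integrable_sq.add (hφ.memLp_partialD 1 2 volume).integrable_sq
  have hle : ∫ z, (2⁻¹ * (φ z ^ 2 / (distSq c z + δ) ^ 2) -
      1 / (2 * δ) * (partialD 0 φ z ^ 2 + partialD 1 φ z ^ 2)) ≤ 0 := by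
    rw [← hzero]
    refine integral_mono ((hi1.const_mul _).sub (hi2.const_mul _)) ((hint 0).add (hint 1))
      fun z => ?_
    simp only [hd]
    refine hardy_pointwise (x := z 0 - c 0) (y := z 1 - c 1) hδ ?_
    by_cases hz : φ z = 0
    · exact Or.inl hz
    · right
      have := hD z (hφ.support_subset (subset_tsupport φ hz))
      rw [hδe]
      have h2 := distSq_eq c z
      unfold distSq at h2
      rw [h2]
      nlinarith
  rw [integral_sub (hi1.const_mul _) (hi2.const_mul _), integral_const_mul,
    integral_const_mul] at hle
  have hδ3 : 3 / ρ ^ 2 = 2 * (1 / (2 * δ)) := by rw [hδe]; field_simp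
  rw [hδ3]
  linarith

/-! ### A solenoidal field with a logarithmic cut-off -/

/-- The rotated gradient of the stream function `lam (z₁ - c₁) q(log (1 + |z - c|²))`. -/
noncomputable def cutoffField (q : ℝ → ℝ) (lam : ℝ) (c : Plane) (i : Fin 2) (z : Plane) : ℝ :=
  if i = 0 then
    lam * (q (Real.log (1 + distSq c z)) + deriv q (Real.log (1 + distSq c z)) *
      (2 * (z 1 - c 1) ^ 2 / (1 + distSq c z)))
  else
    -(lam * (deriv q (Real.log (1 + distSq c z)) *
      (2 * ((z 0 - c 0) * (z 1 - c 1)) / (1 + distSq c z))))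

theorem one_add_distSq_pos (c z : Plane) : 0 < 1 + distSq c z := by
  have := distSq_nonneg c z
  positivity

theorem contDiff_deriv_of_contDiff {q : ℝ → ℝ} (hq : ContDiff ℝ ∞ q) : ContDiff ℝ ∞ (deriv q) :=
  (contDiff_infty_iff_deriv.1 hq).2

theorem contDiff_cutoffField {q : ℝ → ℝ} (hq : ContDiff ℝ ∞ q)
    (lam : ℝ) (c : Plane) (i : Fin 2) :
    ContDiff ℝ ∞ (cutoffField q lam c i) := by
  have hP : ContDiff ℝ ∞ fun z => 1 + distSq c z := contDiff_const.add (contDiff_distSq c)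
  have hne : ∀ z, 1 + distSq c z ≠ 0 := fun z => (one_add_distSq_pos c z).ne'
  have hl : ContDiff ℝ ∞ fun z => Real.log (1 + distSq c z) := hP.log hne
  have hx : ∀ j, ContDiff ℝ ∞ fun z : Plane => z j - c j := fun j =>
    (contDiff_coord j).sub contDiff_const
  have hq' := contDiff_deriv_of_contDiff hq
  unfold cutoffField
  by_cases hi : i = 0
  · simp only [hi, if_true]
    exact contDiff_const.mul ((hq.comp hl).add ((hq'.comp hl).mul
      ((contDiff_const.mul ((hx 1).pow 2)).div hP hne)))
  · simp only [hi, if_false]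
    exact (contDiff_const.mul ((hq'.comp hl).mul
      ((contDiff_const.mul ((hx 0).mul (hx 1))).div hP hne))).neg

theorem hasDerivAt_comp_log_distSq {q : ℝ → ℝ} (hq : ContDiff ℝ ∞ q)
    (c z : Plane) (j : Fin 2) :
    HasDerivAt (fun t : ℝ => q (Real.log (1 + distSq c (z + t • EuclideanSpace.single j (1 : ℝ)))))
      (deriv q (Real.log (1 + distSq c z)) * (2 * (z j - c j) / (1 + distSq c z))) 0 := by
  have h1 := ((hasDerivAt_distSq c z j).const_add 1).log
    (by simpa using (one_add_distSq_pos c z).ne')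
  have h2 : HasDerivAt q (deriv q (Real.log (1 + distSq c z))) (Real.log (1 + distSq c
      (z + (0 : ℝ) • EuclideanSpace.single j (1 : ℝ)))) := by
    simpa using (hq.differentiable (by simp) (Real.log (1 + distSq c z))).hasDerivAt
  have h3 := h2.comp (0 : ℝ) h1
  simpa using! h3

theorem partialD_cutoffField_zero {q : ℝ → ℝ} (hq : ContDiff ℝ ∞ q)
    (lam : ℝ) (c z : Plane) (j : Fin 2) :
    partialD j (cutoffField q lam c 0) z = lam *
      (deriv q (Real.log (1 + distSq c z)) * (2 * (z j - c j) / (1 + distSq c z)) +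
        (deriv (deriv q) (Real.log (1 + distSq c z)) * (2 * (z j - c j) / (1 + distSq c z)) *
          (2 * (z 1 - c 1) ^ 2 / (1 + distSq c z)) + deriv q (Real.log (1 + distSq c z)) *
          ((4 * (z 1 - c 1) * (if 1 = j then 1 else 0) * (1 + distSq c z) -
            2 * (z 1 - c 1) ^ 2 * (2 * (z j - c j))) / (1 + distSq c z) ^ 2))) := by
  refine partialD_eq_of_hasDerivAt ((contDiff_cutoffField hq lam c 0).differentiable (by simp) z) ?_
  have hP := ((hasDerivAt_distSq c z j).const_add 1)
  have h := ((hasDerivAt_comp_log_distSq hq c z j).add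
    ((hasDerivAt_comp_log_distSq (contDiff_deriv_of_contDiff hq) c z j).mul
      (((((hasDerivAt_coord z 1 j).sub_const (c 1)).pow 2).const_mul 2).div hP
        (by simpa using (one_add_distSq_pos c z).ne')))).const_mul lam
  unfold cutoffField
  convert! h using 1
  simp only [zero_smul, add_zero, Pi.div_apply, Pi.pow_apply, Nat.cast_ofNat,
    Nat.add_one_sub_one, pow_one]
  ring

theorem partialD_cutoffField_one {q : ℝ → ℝ} (hq : ContDiff ℝ ∞ q)
    (lam : ℝ) (c z : Plane) (j : Fin 2) :
    partialD j (cutoffField q lam c 1) z = -(lam *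
      (deriv (deriv q) (Real.log (1 + distSq c z)) * (2 * (z j - c j) / (1 + distSq c z)) *
          (2 * ((z 0 - c 0) * (z 1 - c 1)) / (1 + distSq c z)) +
        deriv q (Real.log (1 + distSq c z)) *
          ((2 * ((if 0 = j then 1 else 0) * (z 1 - c 1) + (z 0 - c 0) * (if 1 = j then 1 else 0)) *
            (1 + distSq c z) - 2 * ((z 0 - c 0) * (z 1 - c 1)) * (2 * (z j - c j))) /
            (1 + distSq c z) ^ 2))) := by
  refine partialD_eq_of_hasDerivAt ((contDiff_cutoffField hq lam c 1).differentiable (by simp) z) ?_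
  have hP := ((hasDerivAt_distSq c z j).const_add 1)
  have h := (((hasDerivAt_comp_log_distSq (contDiff_deriv_of_contDiff hq) c z j).mul
      (((((hasDerivAt_coord z 0 j).sub_const (c 0)).mul
        ((hasDerivAt_coord z 1 j).sub_const (c 1))).const_mul 2).div hP
        (by simpa using (one_add_distSq_pos c z).ne'))).const_mul lam).neg
  unfold cutoffField
  convert! h using 1
  simp

theorem divergence_cutoffField {q : ℝ → ℝ} (hq : ContDiff ℝ ∞ q)
    (lam : ℝ) (c z : Plane) :
    partialD 0 (cutoffField q lam c 0) z + partialD 1 (cutoffField q lam c 1) z = 0 := by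
  rw [partialD_cutoffField_zero hq, partialD_cutoffField_one hq]
  have := (one_add_distSq_pos c z).ne'
  simp
  field_simp
  ring

/-- In the scaled coordinates `(z - c) / r`, with `r = √(1 + |z - c|²)`, which are bounded by `1`,
each term of the derivative is `1 / r` times a bounded factor. The constant is `14 = 10 + 4`: at
most `10` from the terms in `q'` and `4` from those in `q''`. -/
theorem sq_partialD_cutoffField_le {q : ℝ → ℝ} (hq : ContDiff ℝ ∞ q)
    {K : ℝ} (h1 : ∀ t, |deriv q t| ≤ K)
    (h2 : ∀ t, |deriv (deriv q) t| ≤ K) (lam : ℝ) (c : Plane) (i j : Fin 2) (z : Plane) :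
    partialD j (cutoffField q lam c i) z ^ 2 ≤ (14 * K * lam) ^ 2 / (1 + distSq c z) := by
  have hP := one_add_distSq_pos c z
  obtain ⟨r, hr⟩ : ∃ r, r = √(1 + distSq c z) := ⟨_, rfl⟩
  have hr0 : 0 < r := by rw [hr]; positivity
  have hr2 : 1 + distSq c z = r ^ 2 := by rw [hr, Real.sq_sqrt hP.le]
  have hcoord : ∀ k : Fin 2, ∃ u, z k - c k = r * u ∧ |u| ≤ 1 := by
    intro k
    refine ⟨(z k - c k) / r, by field_simp, ?_⟩
    rw [abs_div, abs_of_pos hr0, div_le_one hr0]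
    refine abs_le_of_sq_le_sq (a := z k - c k) ?_ hr0.le
    rw [← hr2]
    unfold distSq
    fin_cases k <;> simp <;> nlinarith [sq_nonneg (z 0 - c 0), sq_nonneg (z 1 - c 1)]
  obtain ⟨u, hu, hu1⟩ := hcoord 0
  obtain ⟨v, hv, hv1⟩ := hcoord 1
  obtain ⟨s, hs, hs1⟩ := hcoord j
  have hK : 0 ≤ K := (abs_nonneg _).trans (h1 0)
  have main : ∃ E, |E| ≤ 14 * K ∧ partialD j (cutoffField q lam c i) z = lam * E / r := by
    have ind : ∀ k : Fin 2, |(if k = j then 1 else 0 : ℝ)| ≤ 1 := by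
      intro k; split_ifs <;> simp
    have hm : ∀ {a b : ℝ}, |a| ≤ 1 → |b| ≤ 1 → |a * b| ≤ 1 := by
      intro a b ha hb
      rw [abs_mul]
      exact mul_le_one₀ ha (abs_nonneg _) hb
    have hmul : ∀ {a b A B : ℝ}, |a| ≤ A → |b| ≤ B → |a * b| ≤ A * B := by
      intro a b A B ha hb
      rw [abs_mul]
      exact mul_le_mul ha hb (abs_nonneg _) ((abs_nonneg _).trans ha)
    have hq1 := h1 (Real.log (1 + distSq c z))
    have hq2 := h2 (Real.log (1 + distSq c z))
    by_cases hi : i = 0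
    · refine ⟨deriv q (Real.log (1 + distSq c z)) *
        (2 * s + 4 * (v * (if 1 = j then 1 else 0)) - 4 * (v * (v * s))) +
        deriv (deriv q) (Real.log (1 + distSq c z)) * (4 * (v * (v * s))), ?_, ?_⟩
      · have b1 : |2 * s + 4 * (v * (if 1 = j then 1 else 0)) - 4 * (v * (v * s))| ≤ 10 := by
          have e1 := abs_le.1 (hm hv1 (ind 1))
          have e2 := abs_le.1 (hm hv1 (hm hv1 hs1))
          have e3 := abs_le.1 hs1
          rw [abs_le]; constructor <;> linarith [e1.1, e1.2, e2.1, e2.2, e3.1, e3.2]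
        have b2 : |4 * (v * (v * s))| ≤ 4 := by
          rw [abs_mul, abs_of_pos four_pos]; linarith [hm hv1 (hm hv1 hs1)]
        refine (abs_add_le _ _).trans ?_
        linarith [hmul hq1 b1, hmul hq2 b2]
      · subst hi
        rw [partialD_cutoffField_zero hq, hs, hv, hr2]
        field_simp
        ring
    · have hi1 : i = 1 := by omega
      refine ⟨-(deriv q (Real.log (1 + distSq c z)) *
        (2 * ((if 0 = j then 1 else 0) * v) + 2 * (u * (if 1 = j then 1 else 0)) -
          4 * (u * (v * s))) +
        deriv (deriv q) (Real.log (1 + distSq c z)) * (4 * (u * (v * s)))), ?_, ?_⟩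
      · have b1 : |2 * ((if 0 = j then 1 else 0) * v) + 2 * (u * (if 1 = j then 1 else 0)) -
          4 * (u * (v * s))| ≤ 8 := by
          have e1 := abs_le.1 (hm (ind 0) hv1)
          have e2 := abs_le.1 (hm hu1 (ind 1))
          have e3 := abs_le.1 (hm hu1 (hm hv1 hs1))
          rw [abs_le]; constructor <;> linarith [e1.1, e1.2, e2.1, e2.2, e3.1, e3.2]
        have b2 : |4 * (u * (v * s))| ≤ 4 := by
          rw [abs_mul, abs_of_pos four_pos]; linarith [hm hu1 (hm hv1 hs1)]
        rw [abs_neg]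
        refine (abs_add_le _ _).trans ?_
        linarith [hmul hq1 b1, hmul hq2 b2]
      · subst hi1
        rw [partialD_cutoffField_one hq, hs, hu, hv, hr2]
        field_simp
        ring
  obtain ⟨E, hE, hd⟩ := main
  rw [hd, hr2, div_pow]
  gcongr ?_ / _
  rw [mul_pow, mul_pow (14 * K), mul_comm]
  refine mul_le_mul_of_nonneg_right ?_ (sq_nonneg lam)
  exact sq_le_sq' (abs_le.1 hE).1 (abs_le.1 hE).2

theorem abs_cutoffField_le {q : ℝ → ℝ} {K : ℝ} (h0 : ∀ t, |q t| ≤ 1) (h1 : ∀ t, |deriv q t| ≤ K) {lam : ℝ}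
    (hlam : 0 ≤ lam) (c : Plane) (i : Fin 2) (z : Plane) :
    |cutoffField q lam c i z| ≤ (1 + 2 * K) * lam := by
  have hP := one_add_distSq_pos c z
  have hK : 0 ≤ K := (abs_nonneg _).trans (h1 0)
  have hq0 := h0 (Real.log (1 + distSq c z))
  have hq1 := h1 (Real.log (1 + distSq c z))
  unfold cutoffField
  split_ifs
  · have hb : |2 * (z 1 - c 1) ^ 2 / (1 + distSq c z)| ≤ 2 := by
      rw [abs_of_nonneg (by positivity), div_le_iff₀ hP]
      unfold distSq
      nlinarith [sq_nonneg (z 0 - c 0)]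
    rw [abs_mul, abs_of_nonneg hlam, mul_comm]
    gcongr
    refine (abs_add_le _ _).trans ?_
    rw [abs_mul]
    nlinarith [mul_le_mul hq1 hb (abs_nonneg _) hK]
  · have hb : |2 * ((z 0 - c 0) * (z 1 - c 1)) / (1 + distSq c z)| ≤ 2 := by
      rw [abs_div, abs_of_pos hP, div_le_iff₀ hP, abs_le]
      unfold distSq
      constructor <;> nlinarith [sq_nonneg (z 0 - c 0 + (z 1 - c 1)),
        sq_nonneg (z 0 - c 0 - (z 1 - c 1)), sq_nonneg (z 0 - c 0), sq_nonneg (z 1 - c 1)]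
    rw [abs_neg, abs_mul, abs_of_nonneg hlam, mul_comm]
    gcongr
    rw [abs_mul]
    nlinarith [mul_le_mul hq1 hb (abs_nonneg _) hK]

/-- Both derivatives are continuous and vanish off `[0, 1]`, so compactness bounds them. -/
theorem exists_bound_deriv_smoothTransition :
    ∃ K : ℝ, 0 < K ∧ (∀ t, |deriv Real.smoothTransition t| ≤ K) ∧
      ∀ t, |deriv (deriv Real.smoothTransition) t| ≤ K := by
  have hs : ContDiff ℝ ∞ Real.smoothTransition := Real.smoothTransition.contDiff
  have h1 := contDiff_deriv_of_contDiff hs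
  have h2 := contDiff_deriv_of_contDiff h1
  have hz1 : ∀ t, t ∉ Set.Icc (0 : ℝ) 1 → ∀ᶠ s in 𝓝 t, deriv Real.smoothTransition s = 0 := by
    intro t ht
    have : ∀ᶠ s in 𝓝 t, s ∈ (Set.Icc (0 : ℝ) 1)ᶜ := isClosed_Icc.isOpen_compl.mem_nhds ht
    filter_upwards [eventually_eventually_nhds.2 this] with s hs
    by_cases h : s < 0
    · have : Real.smoothTransition =ᶠ[𝓝 s] fun _ => 0 := by
        filter_upwards [Iio_mem_nhds h] with r hr
        exact Real.smoothTransition.zero_of_nonpos (le_of_lt hr)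
      simp [this.deriv_eq]
    · have h' : 1 < s := by
        by_contra h'
        exact hs.self_of_nhds ⟨not_lt.1 h, not_lt.1 h'⟩
      have : Real.smoothTransition =ᶠ[𝓝 s] fun _ => 1 := by
        filter_upwards [Ioi_mem_nhds h'] with r hr
        exact Real.smoothTransition.one_of_one_le (le_of_lt hr)
      simp [this.deriv_eq]
  obtain ⟨K1, hK1⟩ := isCompact_Icc.exists_bound_of_continuousOn (h1.continuous.continuousOn
    (s := Set.Icc (0 : ℝ) 1))
  obtain ⟨K2, hK2⟩ := isCompact_Icc.exists_bound_of_continuousOn (h2.continuous.continuousOn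
    (s := Set.Icc (0 : ℝ) 1))
  refine ⟨max (max K1 K2) 1, by positivity, fun t => ?_, fun t => ?_⟩
  · by_cases ht : t ∈ Set.Icc (0 : ℝ) 1
    · exact (hK1 t ht).trans (by simp)
    · rw [(hz1 t ht).self_of_nhds]; simp
  · by_cases ht : t ∈ Set.Icc (0 : ℝ) 1
    · exact (hK2 t ht).trans (by simp)
    · have : deriv Real.smoothTransition =ᶠ[𝓝 t] fun _ => 0 := hz1 t ht
      rw [this.deriv_eq]; simp

/-- The solenoidal field `A` interpolates between `0` for `|z - c| < M` and `lam e₁` for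
`1 + |z - c|² > T`. -/
structure IsCutoffField (K : ℝ) (c : Plane) (M T lam : ℝ) (A : Fin 2 → Plane → ℝ) : Prop where
  smooth : ∀ i, ContDiff ℝ ∞ (A i)
  inner : ∀ i z, dist z c < M → A i z = 0
  outer : ∀ i z, T < 1 + distSq c z → A i z = if i = 0 then lam else 0
  divergence : ∀ z, ∑ i, partialD i (A i) z = 0
  bound : ∀ i z, |A i z| ≤ K * lam
  bound_grad : ∀ i j z, partialD j (A i) z ^ 2 ≤
    (K * lam / (Real.log T - Real.log (1 + M ^ 2))) ^ 2 / (1 + distSq c z)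
  grad_outer : ∀ i j z, T < 1 + distSq c z → partialD j (A i) z = 0

theorem exists_isCutoffField : ∃ K : ℝ, 0 < K ∧ ∀ (c : Plane) (M T lam : ℝ), 0 < M → 0 < T →
    0 ≤ lam → 1 ≤ Real.log T - Real.log (1 + M ^ 2) →
    ∃ A : Fin 2 → Plane → ℝ, IsCutoffField K c M T lam A := by
  obtain ⟨K, hK, hK1, hK2⟩ := exists_bound_deriv_smoothTransition
  -- `14 K` serves the gradient bound; the sup bound `1 + 2 K` is also below `14 K + 1`.
  refine ⟨14 * K + 1, by positivity, fun c M T lam hM hT hlam hb => ?_⟩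
  obtain ⟨a, ha⟩ : ∃ a, a = Real.log (1 + M ^ 2) := ⟨_, rfl⟩
  obtain ⟨b, hbe⟩ : ∃ b, b = Real.log T - Real.log (1 + M ^ 2) := ⟨_, rfl⟩
  rw [← hbe] at hb
  have hb0 : 0 < b := by linarith
  have hs : ContDiff ℝ ∞ Real.smoothTransition := Real.smoothTransition.contDiff
  -- The transition occupies `[a, a + b] = [log (1 + M²), log T]`. Each derivative of `q` gains a
  -- factor `1 / b`, and `1 ≤ b` lets `K / b` bound the second derivative too.
  obtain ⟨q, hqe⟩ : ∃ q : ℝ → ℝ, q = fun t => Real.smoothTransition ((t - a) / b) := ⟨_, rfl⟩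
  have hq : ContDiff ℝ ∞ q := by
    rw [hqe]
    exact hs.comp ((contDiff_id.sub contDiff_const).div_const b)
  have hchain : ∀ {f : ℝ → ℝ}, ContDiff ℝ ∞ f → ∀ t,
      deriv (fun t => f ((t - a) / b)) t = deriv f ((t - a) / b) / b := by
    intro f hf t
    have h1 : HasDerivAt (fun t => (t - a) / b) (1 / b) t :=
      ((hasDerivAt_id t).sub_const a).div_const b
    have h2 := (hf.differentiable (by simp) ((t - a) / b)).hasDerivAt.comp t h1
    rw [mul_one_div] at h2
    exact h2.deriv
  have hd1 : deriv q = fun t => deriv Real.smoothTransition ((t - a) / b) / b := by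
    ext t; rw [hqe, hchain hs]
  have hd2 : ∀ t, deriv (deriv q) t =
      deriv (deriv Real.smoothTransition) ((t - a) / b) / b / b := by
    intro t
    rw [hd1, deriv_div_const, hchain (contDiff_deriv_of_contDiff hs)]
  have hq0 : ∀ t, |q t| ≤ 1 := by
    intro t
    rw [hqe, abs_of_nonneg (Real.smoothTransition.nonneg _)]
    exact Real.smoothTransition.le_one _
  have hq1 : ∀ t, |deriv q t| ≤ K / b := by
    intro t
    rw [hd1, abs_div, abs_of_pos hb0]
    gcongr
    exact hK1 _
  have hq2 : ∀ t, |deriv (deriv q) t| ≤ K / b := by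
    intro t
    rw [hd2, abs_div, abs_div, abs_of_pos hb0]
    refine (div_le_self (by positivity) hb).trans ?_
    gcongr
    exact hK2 _
  have hKb : K / b ≤ K := div_le_self hK.le hb
  have hlow : ∀ t, t < a → q t = 0 ∧ deriv q t = 0 := by
    have h : ∀ t, t < a → q t = 0 := fun t ht => by
      rw [hqe]
      exact Real.smoothTransition.zero_of_nonpos (div_nonpos_of_nonpos_of_nonneg (by linarith) hb0.le)
    refine fun t ht => ⟨h t ht, ?_⟩
    have : q =ᶠ[𝓝 t] fun _ => 0 := by
      filter_upwards [Iio_mem_nhds ht] with s hs using h s hs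
    rw [this.deriv_eq]; simp
  have hhigh : ∀ t, Real.log T < t → q t = 1 ∧ deriv q t = 0 := by
    have h : ∀ t, Real.log T < t → q t = 1 := fun t ht => by
      rw [hqe]
      refine Real.smoothTransition.one_of_one_le ?_
      rw [one_le_div hb0]; linarith
    refine fun t ht => ⟨h t ht, ?_⟩
    have : q =ᶠ[𝓝 t] fun _ => 1 := by
      filter_upwards [Ioi_mem_nhds ht] with s hs using h s hs
    rw [this.deriv_eq]; simp
  have houter : ∀ i z, T < 1 + distSq c z → cutoffField q lam c i z = if i = 0 then lam else 0 := by
    intro i z hz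
    obtain ⟨e1, e2⟩ := hhigh _ (Real.log_lt_log hT hz)
    simp [cutoffField, e1, e2]
  refine ⟨cutoffField q lam c, contDiff_cutoffField hq lam c, ?_, houter, ?_, ?_, ?_, ?_⟩
  · intro i z hz
    have : Real.log (1 + distSq c z) < a := by
      rw [ha, distSq_eq]
      refine Real.log_lt_log (by positivity) ?_
      have := dist_nonneg (x := z) (y := c)
      nlinarith
    obtain ⟨e1, e2⟩ := hlow _ this
    simp [cutoffField, e1, e2]
  · intro z
    rw [Fin.sum_univ_two]
    exact divergence_cutoffField hq lam c z
  · intro i z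
    refine (abs_cutoffField_le hq0 hq1 hlam c i z).trans ?_
    refine mul_le_mul_of_nonneg_right ?_ hlam
    linarith
  · intro i j z
    refine (sq_partialD_cutoffField_le hq hq1 hq2 lam c i j z).trans ?_
    have := one_add_distSq_pos c z
    rw [← hbe]
    gcongr ?_ ^ 2 / _
    rw [mul_div_assoc', div_mul_eq_mul_div]
    gcongr
    linarith
  · intro i j z hz
    have hopen : IsOpen {z | T < 1 + distSq c z} :=
      isOpen_lt continuous_const (continuous_const.add (contDiff_distSq c).continuous)
    have : cutoffField q lam c i =ᶠ[𝓝 z] fun _ => if i = 0 then lam else 0 := by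
      filter_upwards [hopen.mem_nhds hz] with y hy using houter i y hy
    rw [partialD_congr this]
    simp [partialD]

/-! ### The energy identity -/

theorem Continuous.memLp_restrict_of_isBounded {D : Set Plane} (hDo : IsOpen D)
    (hDb : Bornology.IsBounded D) {f : Plane → ℝ} (hf : Continuous f) (p : ENNReal) :
    MemLp f p (volume.restrict D) := by
  obtain ⟨r, hr⟩ := hDb.subset_closedBall 0
  obtain ⟨C, hC⟩ := (isCompact_closedBall (0 : Plane) r).exists_bound_of_continuousOn
    hf.continuousOn
  have : IsFiniteMeasure (volume.restrict D) :=
    ⟨by rw [Measure.restrict_apply_univ]; exact hDb.measure_lt_top⟩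
  refine MemLp.of_bound hf.aestronglyMeasurable C ?_
  filter_upwards [ae_restrict_mem hDo.measurableSet] with z hz using hC z (hr hz)

/-- The approximants have bounded gradients in `L²`, hence are bounded in `L⁴` by the Sobolev
inequality; lower semicontinuity passes this bound to `f`. The `L⁴` control is what makes the cubic
convective term meaningful and lets it pass to the limit. -/
theorem IsW12Zero.exists_approx {D : Set Plane} (hDb : Bornology.IsBounded D) {f : Plane → ℝ}
    {g : Fin 2 → Plane → ℝ} (h : IsW12Zero D f g) :
    ∃ φ : ℕ → Plane → ℝ, (∀ n, IsTestFunction D (φ n)) ∧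
      Tendsto (fun n => eLpNorm (fun z => φ n z - f z) 2 (volume.restrict D)) atTop (𝓝 0) ∧
      (∀ j, Tendsto (fun n => eLpNorm (fun z => partialD j (φ n) z - g j z) 2 (volume.restrict D))
        atTop (𝓝 0)) ∧
      (∃ B : ENNReal, B ≠ ⊤ ∧ ∀ n, eLpNorm (φ n) 4 (volume.restrict D) ≤ B) ∧
      MemLp f 4 (volume.restrict D) := by
  obtain ⟨φ, hφ, hlim, hlimg⟩ := h.approx
  obtain ⟨C, hC, hCle⟩ := exists_eLpNorm_four_le hDb
  choose B hB hBle using fun j => exists_eLpNorm_le_of_tendsto (by norm_num)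
    (fun n => (hφ n).memLp_partialD j 2 (volume.restrict D)) (h.memLp_grad j) (hlimg j)
  have hfin : C * ∑ j, B j ≠ ⊤ := ENNReal.mul_ne_top hC (by simp [hB])
  have hle : ∀ n, eLpNorm (φ n) 4 (volume.restrict D) ≤ C * ∑ j, B j := fun n =>
    (hCle _ (hφ n)).trans (by gcongr with j; exact hBle j n)
  refine ⟨φ, hφ, hlim, hlimg, ⟨_, hfin, hle⟩, h.memLp.1, ?_⟩
  exact (eLpNorm_le_of_tendsto_eLpNorm two_ne_zero
    (fun n => (hφ n).smooth.continuous.aestronglyMeasurable) h.memLp.1 hlim hle).trans_lt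
    hfin.lt_top

/-- The convective term is skew-symmetric: `∫ (w · ∇φ) φ = 0` for solenoidal `w`. -/
theorem sum_integral_mul_partialD_mul_self {D : Set Plane} {w : Fin 2 → Plane → ℝ}
    {G : Fin 2 → Fin 2 → Plane → ℝ} (hw : ∀ i, IsW12 D (w i) (G i))
    (hdiv : ∀ᵐ z ∂(volume.restrict D), ∑ i, G i i z = 0) {φ : Plane → ℝ}
    (hφ : IsTestFunction D φ) :
    ∑ j, ∫ z in D, w j z * partialD j φ z * φ z = 0 := by
  have hsq := hφ.mul hφ.smooth
  -- Here `φ ∂ⱼφ = ½ ∂ⱼ(φ²)`, and `φ²` is an admissible test function for the weak derivative of `w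
  -- j`.
  have h1 : ∀ j, ∫ z in D, w j z * partialD j φ z * φ z =
      -2⁻¹ * ∫ z in D, G j j z * (φ z * φ z) := by
    intro j
    have h := (hw j).weak_partial j _ hsq
    have e : ∀ z, w j z * partialD j (fun z => φ z * φ z) z =
        2 * (w j z * partialD j φ z * φ z) := fun z => by
      rw [partialD_mul (hφ.differentiable z) (hφ.differentiable z)]
      ring
    simp_rw [e] at h
    rw [integral_const_mul] at h
    linarith
  have hint : ∀ j, Integrable (fun z => G j j z * (φ z * φ z)) (volume.restrict D) := fun j =>
    ((hw j).memLp_grad j).integrable_mul (hsq.memLp 2 (volume.restrict D))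
  simp_rw [h1]
  rw [← Finset.mul_sum, ← integral_finsetSum _ fun j _ => hint j]
  have : ∫ z in D, ∑ j, G j j z * (φ z * φ z) = 0 := by
    refine integral_eq_zero_of_ae ?_
    filter_upwards [hdiv] with z hz
    rw [← Finset.sum_mul, hz, zero_mul, Pi.zero_apply]
  rw [this, mul_zero]

/-- The equation is tested with approximants `φ n → v`. Skew-symmetry is applied to the smooth `φ
n`, before the limit, so it is never needed for `v` itself. The pressure term stays, since a single
component carries no divergence condition. -/
theorem energy_identity_component {D : Set Plane} (hDo : IsOpen D) (hDb : Bornology.IsBounded D)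
    {w : Fin 2 → Plane → ℝ} {G : Fin 2 → Fin 2 → Plane → ℝ} {p : Plane → ℝ}
    (hw : ∀ i, IsW12 D (w i) (G i)) (hw4 : ∀ i, MemLp (w i) 4 (volume.restrict D))
    (hp : MemLp p 2 (volume.restrict D))
    (hdiv : ∀ᵐ z ∂(volume.restrict D), ∑ i, G i i z = 0) (i : Fin 2)
    (hmom : ∀ φ : Plane → ℝ, IsTestFunction D φ → ∫ z in D,
      ((∑ j, G i j z * partialD j φ z) + (∑ j, w j z * G i j z) * φ z - p z * partialD i φ z) = 0)
    {A v : Plane → ℝ} {g : Fin 2 → Plane → ℝ} (hA : ContDiff ℝ ∞ A) (hv : IsW12Zero D v g)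
    (hg : ∀ j z, g j z = G i j z - partialD j A z) :
    (∑ j, ∫ z in D, G i j z * g j z) + (∑ j, ∫ z in D, w j z * partialD j A z * v z) -
      ∫ z in D, p z * g i z = 0 := by
  obtain ⟨φ, hφ, hlim, hlimg, ⟨B, hB, hBle⟩, -⟩ := hv.exists_approx hDb
  have hdA : ∀ j, MemLp (partialD j A) 4 (volume.restrict D) := fun j =>
    (contDiff_partialD hA j).continuous.memLp_restrict_of_isBounded hDo hDb 4
  have hwA : ∀ j, MemLp (fun z => w j z * partialD j A z) 2 (volume.restrict D) := fun j => by
    have := holderTriple_four_four_two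
    exact (hdA j).mul (hw4 j)
  have hgG : ∀ j n, MemLp (fun z => g j z - partialD j (φ n) z) 2 (volume.restrict D) := fun j n =>
    (hv.memLp_grad j).sub ((hφ n).memLp_partialD j 2 _)
  have l1 : ∀ j, Tendsto (fun n => ∫ z in D, G i j z * partialD j (φ n) z) atTop
      (𝓝 (∫ z in D, G i j z * g j z)) := fun j =>
    tendsto_integral_mul_of_tendsto_eLpNorm_left (fun n => (hφ n).memLp_partialD j 2 _)
      (hv.memLp_grad j) ((hw i).memLp_grad j) (hlimg j)
  have l2 : ∀ j, Tendsto (fun n => ∫ z in D, w j z * partialD j A z * φ n z) atTop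
      (𝓝 (∫ z in D, w j z * partialD j A z * v z)) := fun j =>
    tendsto_integral_mul_of_tendsto_eLpNorm_left (fun n => (hφ n).memLp 2 _)
      hv.memLp (hwA j) hlim
  have l3 : ∀ j, Tendsto (fun n => ∫ z in D, w j z * (g j z - partialD j (φ n) z) * φ n z) atTop
      (𝓝 0) := fun j => by
    refine tendsto_integral_mul_mul_zero (hw4 j) (hgG j) (fun n => (hφ n).memLp 4 _) ?_ hB hBle
    refine (hlimg j).congr fun n => ?_
    rw [← eLpNorm_neg]
    congr 1
    ext z
    simp
  have l4 : Tendsto (fun n => ∫ z in D, p z * partialD i (φ n) z) atTop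
      (𝓝 (∫ z in D, p z * g i z)) :=
    tendsto_integral_mul_of_tendsto_eLpNorm_left (fun n => (hφ n).memLp_partialD i 2 _)
      (hv.memLp_grad i) hp (hlimg i)
  have hlimit := ((tendsto_finsetSum Finset.univ fun j _ => l1 j).add
    (tendsto_finsetSum Finset.univ fun j _ => (l2 j).add (l3 j))).sub l4
  have hzero : ∀ n, (∑ j, ∫ z in D, G i j z * partialD j (φ n) z) +
      (∑ j, ((∫ z in D, w j z * partialD j A z * φ n z) +
        ∫ z in D, w j z * (g j z - partialD j (φ n) z) * φ n z)) -
      ∫ z in D, p z * partialD i (φ n) z = 0 := by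
    intro n
    have hφ4 := (hφ n).memLp 4 (volume.restrict D)
    have i1 : ∀ j, Integrable (fun z => G i j z * partialD j (φ n) z) (volume.restrict D) :=
      fun j => ((hw i).memLp_grad j).integrable_mul ((hφ n).memLp_partialD j 2 _)
    have i2 : ∀ j, Integrable (fun z => w j z * G i j z * φ n z) (volume.restrict D) :=
      fun j => (hw4 j).integrable_mul_mul ((hw i).memLp_grad j) hφ4
    have i3 : Integrable (fun z => p z * partialD i (φ n) z) (volume.restrict D) :=
      hp.integrable_mul ((hφ n).memLp_partialD i 2 _)
    have i4 : ∀ j, Integrable (fun z => w j z * partialD j A z * φ n z) (volume.restrict D) :=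
      fun j => (hwA j).integrable_mul ((hφ n).memLp 2 _)
    have i5 : ∀ j, Integrable (fun z => w j z * (g j z - partialD j (φ n) z) * φ n z)
        (volume.restrict D) := fun j => (hw4 j).integrable_mul_mul (hgG j n) hφ4
    have i6 : ∀ j, Integrable (fun z => w j z * partialD j (φ n) z * φ n z)
        (volume.restrict D) :=
      fun j => (hw4 j).integrable_mul_mul ((hφ n).memLp_partialD j 2 _) hφ4
    have hm := hmom _ (hφ n)
    simp_rw [Finset.sum_mul] at hm
    have s1 : Integrable (fun z => ∑ j, G i j z * partialD j (φ n) z) (volume.restrict D) :=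
      integrable_finsetSum _ fun j _ => i1 j
    have s2 : Integrable (fun z => ∑ j, w j z * G i j z * φ n z) (volume.restrict D) :=
      integrable_finsetSum _ fun j _ => i2 j
    rw [integral_sub (s1.fun_add s2) i3, integral_add s1 s2, integral_finsetSum _ fun j _ => i1 j,
      integral_finsetSum _ fun j _ => i2 j] at hm
    -- Writes `∂ⱼw = ∂ⱼA + (∂ⱼv - ∂ⱼφₙ) + ∂ⱼφₙ`: the first part converges, the second tends to `0`
    -- by the `L⁴`–`L²`–`L⁴` estimate, and the third cancels after summation over `j`.
    have hsplit : ∀ j, ∫ z in D, w j z * G i j z * φ n z =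
        (∫ z in D, w j z * partialD j A z * φ n z) +
        (∫ z in D, w j z * (g j z - partialD j (φ n) z) * φ n z) +
        ∫ z in D, w j z * partialD j (φ n) z * φ n z := fun j => by
      rw [← integral_add (i4 j) (i5 j), ← integral_add ((i4 j).fun_add (i5 j)) (i6 j)]
      refine integral_congr_ae (Eventually.of_forall fun z => ?_)
      simp only [hg]
      ring
    simp_rw [hsplit] at hm
    rw [Finset.sum_add_distrib (f := fun j => (∫ z in D, w j z * partialD j A z * φ n z) + _),
      sum_integral_mul_partialD_mul_self hw hdiv (hφ n), add_zero] at hm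
    exact hm
  have := tendsto_nhds_unique hlimit (tendsto_const_nhds.congr fun n => (hzero n).symm)
  simpa using this

/-- The energy identity for the difference `v = w - A` of a weak solution `w` and a solenoidal
extension `A` of its boundary values. -/
theorem energy_identity {D : Set Plane} (hDo : IsOpen D) (hDb : Bornology.IsBounded D)
    {w : Fin 2 → Plane → ℝ} {G : Fin 2 → Fin 2 → Plane → ℝ} {p : Plane → ℝ}
    (hw : ∀ i, IsW12 D (w i) (G i)) (hp : MemLp p 2 (volume.restrict D))
    (hdiv : ∀ᵐ z ∂(volume.restrict D), ∑ i, G i i z = 0)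
    (hmom : ∀ i, ∀ φ : Plane → ℝ, IsTestFunction D φ → ∫ z in D,
      ((∑ j, G i j z * partialD j φ z) + (∑ j, w j z * G i j z) * φ z - p z * partialD i φ z) = 0)
    {A : Fin 2 → Plane → ℝ} (hA : ∀ i, ContDiff ℝ ∞ (A i))
    (hAdiv : ∀ z, ∑ i, partialD i (A i) z = 0)
    (hv : ∀ i, IsW12Zero D (fun z => w i z - A i z) fun j z => G i j z - partialD j (A i) z) :
    (∑ i, ∑ j, ∫ z in D, G i j z * (G i j z - partialD j (A i) z)) +
      ∑ i, ∑ j, ∫ z in D, w j z * partialD j (A i) z * (w i z - A i z) = 0 := by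
  have hw4 : ∀ i, MemLp (w i) 4 (volume.restrict D) := fun i => by
    obtain ⟨-, -, -, -, -, h4⟩ := (hv i).exists_approx hDb
    have := h4.add ((hA i).continuous.memLp_restrict_of_isBounded hDo hDb 4)
    refine this.congr_norm (hw i).memLp.1 (Eventually.of_forall fun z => ?_)
    simp
  -- The pressure disappears on summing over components because `w` and `A` are both solenoidal.
  have hpi : ∑ i, ∫ z in D, p z * (G i i z - partialD i (A i) z) = 0 := by
    have hint : ∀ i, Integrable (fun z => p z * (G i i z - partialD i (A i) z))
        (volume.restrict D) := fun i => hp.integrable_mul ((hv i).memLp_grad i)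
    rw [← integral_finsetSum _ fun i _ => hint i]
    refine integral_eq_zero_of_ae ?_
    filter_upwards [hdiv] with z hz
    rw [← Finset.mul_sum, Finset.sum_sub_distrib, hz, hAdiv]
    simp
  have hsum := Finset.sum_eq_zero fun i (_ : i ∈ Finset.univ) =>
    energy_identity_component hDo hDb hw hw4 hp hdiv i (hmom i) (hA i) (hv i) fun _ _ => rfl
  rw [Finset.sum_sub_distrib, Finset.sum_add_distrib, hpi, sub_zero] at hsum
  exact hsum

/-! ### The energy estimate -/

theorem setIntegral_eq_integral_of_support_subset {D : Set Plane} {F : Plane → ℝ}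
    (h : Function.support F ⊆ D) : ∫ z in D, F z = ∫ z, F z :=
  setIntegral_eq_integral_of_forall_compl_eq_zero fun z hz => by
    by_contra hne
    exact hz (h hne)

theorem measurableSet_one_add_distSq_le (c : Plane) (T : ℝ) :
    MeasurableSet {z | 1 + distSq c z ≤ T} :=
  (isClosed_le (continuous_const.add (contDiff_distSq c).continuous)
    continuous_const).measurableSet

/-- On this region `|z - c|² + ρ²/3 ≤ (1 + ρ²/3) T`, so the Hardy weight is bounded below there; its
square produces the factor `T²`. -/
theorem IsTestFunction.integral_sq_le {D : Set Plane} {φ : Plane → ℝ}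
    (hφ : IsTestFunction D φ) {c : Plane} {ρ : ℝ} (hρ : 0 < ρ) (hD : ∀ z ∈ D, ρ ≤ dist z c)
    {T : ℝ} (hT : 1 ≤ T) :
    ∫ z in {z | 1 + distSq c z ≤ T}, φ z ^ 2 ∂(volume.restrict D) ≤
      3 / ρ ^ 2 * (1 + ρ ^ 2 / 3) ^ 2 * T ^ 2 * ∑ j, ∫ z in D, partialD j φ z ^ 2 := by
  have hS := measurableSet_one_add_distSq_le c T
  have hsq : ∀ μ : Measure Plane, IsFiniteMeasureOnCompacts μ → Integrable (fun z => φ z ^ 2) μ :=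
    fun μ _ => (hφ.memLp 2 μ).integrable_sq
  have hpos : ∀ z, 0 < distSq c z + ρ ^ 2 / 3 := fun z => by
    have := distSq_nonneg c z
    positivity
  have hint : Integrable fun z => φ z ^ 2 / (distSq c z + ρ ^ 2 / 3) ^ 2 := by
    have : IsTestFunction D fun z => φ z * (φ z / (distSq c z + ρ ^ 2 / 3) ^ 2) := hφ.mul
      (hφ.smooth.div (((contDiff_distSq c).add contDiff_const).pow 2)
        fun z => (pow_pos (hpos z) 2).ne')
    refine (memLp_one_iff_integrable.1 (this.memLp 1 volume)).congr
      (Eventually.of_forall fun z => ?_)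
    simp only
    ring
  have h1 : ∫ z in {z | 1 + distSq c z ≤ T}, φ z ^ 2 ∂(volume.restrict D) ≤
      ∫ z in {z | 1 + distSq c z ≤ T}, φ z ^ 2 :=
    integral_mono_measure (Measure.restrict_mono le_rfl Measure.restrict_le_self)
      (Eventually.of_forall fun z => sq_nonneg _) (hsq _ inferInstance)
  have h2 : ∫ z in {z | 1 + distSq c z ≤ T}, φ z ^ 2 ≤
      ∫ z in {z | 1 + distSq c z ≤ T},
        ((1 + ρ ^ 2 / 3) * T) ^ 2 * (φ z ^ 2 / (distSq c z + ρ ^ 2 / 3) ^ 2) := by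
    refine setIntegral_mono_on (hsq _ inferInstance) (hint.const_mul _).integrableOn hS
      fun z hz => ?_
    have hz' : 1 + distSq c z ≤ T := hz
    rw [mul_div_assoc', le_div_iff₀ (pow_pos (hpos z) 2), mul_comm]
    refine mul_le_mul_of_nonneg_right ?_ (sq_nonneg _)
    refine pow_le_pow_left₀ (hpos z).le ?_ 2
    nlinarith [sq_nonneg ρ]
  have h3 : ∫ z in {z | 1 + distSq c z ≤ T},
        ((1 + ρ ^ 2 / 3) * T) ^ 2 * (φ z ^ 2 / (distSq c z + ρ ^ 2 / 3) ^ 2) ≤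
      ∫ z, ((1 + ρ ^ 2 / 3) * T) ^ 2 * (φ z ^ 2 / (distSq c z + ρ ^ 2 / 3) ^ 2) :=
    setIntegral_le_integral (hint.const_mul _) (Eventually.of_forall fun z => by
      simp only [Pi.zero_apply]; positivity)
  have h4 := hardy_inequality hρ hφ hD
  have hgrad : ∑ j, ∫ z in D, partialD j φ z ^ 2 =
      ∫ z, (partialD 0 φ z ^ 2 + partialD 1 φ z ^ 2) := by
    rw [Fin.sum_univ_two, integral_add (hφ.memLp_partialD 0 2 volume).integrable_sq
      (hφ.memLp_partialD 1 2 volume).integrable_sq]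
    have hs : ∀ j, Function.support (fun z => partialD j φ z ^ 2) ⊆ D := fun j z hz =>
      hφ.support_subset (support_partialD_subset φ j fun h => hz (by simp [h]))
    rw [setIntegral_eq_integral_of_support_subset (hs 0), setIntegral_eq_integral_of_support_subset (hs 1)]
  rw [hgrad]
  rw [integral_const_mul, integral_const_mul] at h3
  rw [integral_const_mul] at h2
  calc _ ≤ ((1 + ρ ^ 2 / 3) * T) ^ 2 * ∫ z, φ z ^ 2 / (distSq c z + ρ ^ 2 / 3) ^ 2 :=
        h1.trans (h2.trans h3)
    _ ≤ ((1 + ρ ^ 2 / 3) * T) ^ 2 *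
        (3 / ρ ^ 2 * ∫ z, (partialD 0 φ z ^ 2 + partialD 1 φ z ^ 2)) := by gcongr
    _ = _ := by ring

theorem IsW12Zero.integral_sq_le {D : Set Plane} {f : Plane → ℝ} {g : Fin 2 → Plane → ℝ}
    (h : IsW12Zero D f g) {c : Plane} {ρ : ℝ} (hρ : 0 < ρ) (hD : ∀ z ∈ D, ρ ≤ dist z c)
    {T : ℝ} (hT : 1 ≤ T) :
    ∫ z in {z | 1 + distSq c z ≤ T}, f z ^ 2 ∂(volume.restrict D) ≤
      3 / ρ ^ 2 * (1 + ρ ^ 2 / 3) ^ 2 * T ^ 2 * ∑ j, ∫ z in D, g j z ^ 2 := by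
  obtain ⟨φ, hφ, hlim, hlimg⟩ := h.approx
  have hlimS : Tendsto (fun n => eLpNorm (fun z => φ n z - f z) 2
      ((volume.restrict D).restrict {z | 1 + distSq c z ≤ T})) atTop (𝓝 0) :=
    tendsto_of_tendsto_of_tendsto_of_le_of_le tendsto_const_nhds hlim (fun _ => zero_le)
      fun n => eLpNorm_mono_measure _ Measure.restrict_le_self
  have l1 := tendsto_integral_mul_of_tendsto_eLpNorm (fun n => (hφ n).memLp 2 _)
    (fun n => (hφ n).memLp 2 _) (h.memLp.restrict _) (h.memLp.restrict _) hlimS hlimS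
  have l2 := fun j => tendsto_integral_mul_of_tendsto_eLpNorm
    (fun n => (hφ n).memLp_partialD j 2 _) (fun n => (hφ n).memLp_partialD j 2 _)
    (h.memLp_grad j) (h.memLp_grad j) (hlimg j) (hlimg j)
  simp_rw [← sq] at l1 l2
  exact le_of_tendsto_of_tendsto' l1
    ((tendsto_finsetSum Finset.univ fun j _ => l2 j).const_mul _)
    fun n => (hφ n).integral_sq_le hρ hD hT

/-- In polar coordinates about `c` this is `2π ∫ r / (1 + r²) dr` over `0 < r ≤ √(T - 1)`. -/
theorem integral_inv_one_add_distSq (c : Plane) {T : ℝ} (hT : 1 ≤ T) :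
    ∫ z in {z | 1 + distSq c z ≤ T}, 1 / (1 + distSq c z) = Real.pi * Real.log T := by
  obtain ⟨N, hN⟩ : ∃ N, N = √(T - 1) := ⟨_, rfl⟩
  have hN0 : 0 ≤ N := by rw [hN]; positivity
  have hN2 : 1 + N ^ 2 = T := by rw [hN, Real.sq_sqrt (by linarith)]; ring
  have hS := measurableSet_one_add_distSq_le c T
  have e1 : ∫ z in {z | 1 + distSq c z ≤ T}, 1 / (1 + distSq c z) =
      ∫ z : Plane, (Set.Iic N).indicator (fun r : ℝ => 1 / (1 + r ^ 2)) ‖z - c‖ := by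
    rw [← integral_indicator hS]
    refine integral_congr_ae (Eventually.of_forall fun z => ?_)
    have hd : distSq c z = ‖z - c‖ ^ 2 := by rw [distSq_eq, dist_eq_norm]
    have hiff : z ∈ {z | 1 + distSq c z ≤ T} ↔ ‖z - c‖ ∈ Set.Iic N := by
      simp only [Set.mem_ofPred_eq, Set.mem_Iic, hd, ← hN2, add_le_add_iff_left]
      exact pow_le_pow_iff_left₀ (norm_nonneg _) hN0 two_ne_zero
    by_cases hz : z ∈ {z | 1 + distSq c z ≤ T}
    · simp only [Set.indicator_of_mem hz, Set.indicator_of_mem (hiff.1 hz), hd]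
    · simp only [Set.indicator_of_notMem hz, Set.indicator_of_notMem (fun h => hz (hiff.2 h))]
  have e2 : ∫ y in Set.Ioi (0 : ℝ), y ^ (2 - 1) •
      (Set.Iic N).indicator (fun r : ℝ => 1 / (1 + r ^ 2)) y = Real.log T / 2 := by
    have e3 : ∫ y in Set.Ioi (0 : ℝ), y ^ (2 - 1) •
        (Set.Iic N).indicator (fun r : ℝ => 1 / (1 + r ^ 2)) y =
        ∫ y in Set.Ioi (0 : ℝ), (Set.Iic N).indicator (fun y : ℝ => y / (1 + y ^ 2)) y := by
      congr 1
      ext y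
      by_cases hy : y ∈ Set.Iic N
      · simp only [Set.indicator_of_mem hy, smul_eq_mul]; ring
      · simp only [Set.indicator_of_notMem hy, smul_zero]
    rw [e3, setIntegral_indicator measurableSet_Iic, Set.Ioi_inter_Iic,
      ← intervalIntegral.integral_of_le hN0]
    have hderiv : ∀ y ∈ Set.uIcc 0 N,
        HasDerivAt (fun y : ℝ => Real.log (1 + y ^ 2) / 2) (y / (1 + y ^ 2)) y := by
      intro y _
      have hne : 1 + y ^ 2 ≠ 0 := by positivity
      have := (((hasDerivAt_pow 2 y).const_add 1).log hne).div_const 2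
      convert! this using 1
      simp
      ring
    rw [intervalIntegral.integral_eq_sub_of_hasDerivAt hderiv]
    · simp [hN2]
    · refine Continuous.intervalIntegrable ?_ _ _
      exact continuous_id.div (by fun_prop) fun y => by positivity
  rw [e1, integral_sub_right_eq_self
    (fun z : Plane => (Set.Iic N).indicator (fun r : ℝ => 1 / (1 + r ^ 2)) ‖z‖) c,
    integral_fun_norm_addHaar volume
    (fun r => (Set.Iic N).indicator (fun r : ℝ => 1 / (1 + r ^ 2)) r),
    finrank_euclideanSpace_fin, e2]
  have hv : (volume : Measure Plane).real (Metric.ball 0 1) = Real.pi := by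
    rw [Measure.real, EuclideanSpace.volume_ball_fin_two]
    simp [Real.pi_pos.le]
  rw [hv]
  simp
  ring

theorem IsCutoffField.integral_sq_partialD_le {K : ℝ} {c : Plane} {M T lam : ℝ}
    {A : Fin 2 → Plane → ℝ} (hA : IsCutoffField K c M T lam A) (hT : 1 ≤ T) {D : Set Plane}
    (hDo : IsOpen D) (hDb : Bornology.IsBounded D) (i j : Fin 2) :
    ∫ z in D, partialD j (A i) z ^ 2 ≤
      (K * lam / (Real.log T - Real.log (1 + M ^ 2))) ^ 2 * (Real.pi * Real.log T) := by
  have hS := measurableSet_one_add_distSq_le c T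
  have hP := one_add_distSq_pos c
  obtain ⟨B, hB⟩ : ∃ B, B = (K * lam / (Real.log T - Real.log (1 + M ^ 2))) ^ 2 := ⟨_, rfl⟩
  have hB0 : 0 ≤ B := by rw [hB]; positivity
  have hcont : Continuous fun z => 1 / (1 + distSq c z) :=
    continuous_const.div (continuous_const.add (contDiff_distSq c).continuous)
      fun z => (hP z).ne'
  have hcomp : Bornology.IsBounded {z | 1 + distSq c z ≤ T} := by
    refine (Metric.isBounded_closedBall (x := c) (r := T)).subset fun z hz => ?_
    have hz' : 1 + distSq c z ≤ T := hz
    rw [distSq_eq] at hz'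
    rw [Metric.mem_closedBall]
    nlinarith [sq_nonneg (dist z c - 1)]
  have hint : IntegrableOn (fun z => 1 / (1 + distSq c z)) {z | 1 + distSq c z ≤ T} := by
    obtain ⟨r, hr⟩ := hcomp.subset_closedBall 0
    exact (hcont.continuousOn.integrableOn_compact
      (isCompact_closedBall (0 : Plane) r)).mono_set hr
  have hind : Integrable ({z | 1 + distSq c z ≤ T}.indicator fun z => 1 / (1 + distSq c z)) :=
    hint.integrable_indicator hS
  rw [← hB, ← integral_inv_one_add_distSq c hT, ← integral_indicator hS]
  calc ∫ z in D, partialD j (A i) z ^ 2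
      ≤ ∫ z in D, B * {z | 1 + distSq c z ≤ T}.indicator (fun z => 1 / (1 + distSq c z)) z := by
        refine integral_mono ((contDiff_partialD (hA.smooth i) j).continuous.memLp_restrict_of_isBounded
          hDo hDb 2).integrable_sq (hind.const_mul B).integrableOn fun z => ?_
        by_cases hz : 1 + distSq c z ≤ T
        · have hm : z ∈ {z | 1 + distSq c z ≤ T} := hz
          simp only [Set.indicator_of_mem hm]
          rw [hB, mul_one_div]
          exact hA.bound_grad i j z
        · have hm : z ∉ {z | 1 + distSq c z ≤ T} := hz
          simp only [Set.indicator_of_notMem hm, hA.grad_outer i j z (not_le.1 hz)]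
          simp
    _ ≤ ∫ z, B * {z | 1 + distSq c z ≤ T}.indicator (fun z => 1 / (1 + distSq c z)) z :=
        setIntegral_le_integral (hind.const_mul B) (Eventually.of_forall fun z => by
          have : 0 ≤ {z | 1 + distSq c z ≤ T}.indicator (fun z => 1 / (1 + distSq c z)) z :=
            Set.indicator_nonneg (fun z _ => (one_div_pos.2 (hP z)).le) z
          exact mul_nonneg hB0 this)
    _ = _ := integral_const_mul _ _

/-- Integrand of the energy identity for one pair `(i, j)`: `G = ∂ⱼwᵢ`, `d = ∂ⱼAᵢ`, unprimed letters
carry index `i` and primed ones `j`, and `X` dominates `|v|²`. Splitting `w' = (w' - A') + A'` gives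
a term quadratic in `v`, costing `B X`, and a linear one, costing `d² + B² X` by Young. -/
theorem energy_pointwise {G d w A w' A' X B : ℝ} (hd : |d| ≤ B) (hA : |A'| ≤ B)
    (hX : (w - A) ^ 2 ≤ X) (hX' : (w' - A') ^ 2 ≤ X) :
    3 / 4 * (G - d) ^ 2 - 2 * d ^ 2 - (B + B ^ 2) * X ≤
      G * (G - d) + w' * d * (w - A) := by
  have hB : 0 ≤ B := (abs_nonneg _).trans hd
  have h1 : -(1 / 4 * (G - d) ^ 2 + d ^ 2) ≤ d * (G - d) := by
    nlinarith [sq_nonneg ((G - d) / 2 + d)]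
  have h2 : -(B * X) ≤ d * ((w' - A') * (w - A)) := by
    have h : |(w' - A') * (w - A)| ≤ X := by
      rw [abs_le]
      constructor <;> nlinarith [sq_nonneg (w' - A' - (w - A)), sq_nonneg (w' - A' + (w - A))]
    have := mul_le_mul hd h (abs_nonneg _) hB
    rw [← abs_mul] at this
    exact (abs_le.1 this).1
  have h3 : -(d ^ 2 + B ^ 2 * X) ≤ d * (A' * (w - A)) := by
    have hA2 : A' ^ 2 ≤ B ^ 2 := sq_le_sq' (abs_le.1 hA).1 (abs_le.1 hA).2
    have h : A' ^ 2 * (w - A) ^ 2 ≤ B ^ 2 * X := mul_le_mul hA2 hX (sq_nonneg _) (sq_nonneg _)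
    nlinarith [sq_nonneg (d + A' * (w - A)), sq_nonneg d, sq_nonneg (A' * (w - A))]
  nlinarith

/-- With `E = ∫ |∇v|²` and `F = ∫ |∇A|²`, `hsmall` absorbs the convective term and leaves `E ≤ 4 F`.
Then `∫ |∇w|² ≤ 2 E + 2 F ≤ 10 F`, and the four entries of `∇A` turn `10` into `40`. -/
theorem energy_estimate {D : Set Plane} (hDo : IsOpen D) (hDb : Bornology.IsBounded D)
    {w : Fin 2 → Plane → ℝ} {G : Fin 2 → Fin 2 → Plane → ℝ} {p : Plane → ℝ}
    (hw : ∀ i, IsW12 D (w i) (G i)) (hp : MemLp p 2 (volume.restrict D))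
    (hdiv : ∀ᵐ z ∂(volume.restrict D), ∑ i, G i i z = 0)
    (hmom : ∀ i, ∀ φ : Plane → ℝ, IsTestFunction D φ → ∫ z in D,
      ((∑ j, G i j z * partialD j φ z) + (∑ j, w j z * G i j z) * φ z - p z * partialD i φ z) = 0)
    {K : ℝ} {c : Plane} {M T lam ρ : ℝ} {A : Fin 2 → Plane → ℝ}
    (hA : IsCutoffField K c M T lam A) (hK : 0 ≤ K) (hlam : 0 ≤ lam) (hT : 1 ≤ T)
    (hb : 1 ≤ Real.log T - Real.log (1 + M ^ 2))
    (hρ : 0 < ρ) (hD : ∀ z ∈ D, ρ ≤ dist z c)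
    (hsmall : 4 * (K * lam + (K * lam) ^ 2) *
      (3 / ρ ^ 2 * (1 + ρ ^ 2 / 3) ^ 2 * T ^ 2) ≤ 1 / 4)
    (hv : ∀ i, IsW12Zero D (fun z => w i z - A i z) fun j z => G i j z - partialD j (A i) z) :
    ∫ z in D, ∑ i, ∑ j, G i j z ^ 2 ≤
      40 * ((K * lam / (Real.log T - Real.log (1 + M ^ 2))) ^ 2 * (Real.pi * Real.log T)) := by
  have hid := energy_identity hDo hDb hw hp hdiv hmom hA.smooth hA.divergence hv
  have hS := measurableSet_one_add_distSq_le c T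
  have hBpos : 0 ≤ K * lam := by positivity
  have hdA2 : ∀ i j, MemLp (partialD j (A i)) 2 (volume.restrict D) := fun i j =>
    (contDiff_partialD (hA.smooth i) j).continuous.memLp_restrict_of_isBounded hDo hDb 2
  have hdA4 : ∀ i j, MemLp (partialD j (A i)) 4 (volume.restrict D) := fun i j =>
    (contDiff_partialD (hA.smooth i) j).continuous.memLp_restrict_of_isBounded hDo hDb 4
  have hdAle : ∀ i j z, |partialD j (A i) z| ≤ K * lam := by
    intro i j z
    have h1 := distSq_nonneg c z
    refine abs_le_of_sq_le_sq ((hA.bound_grad i j z).trans ?_) hBpos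
    refine (div_le_self (sq_nonneg _) (by linarith)).trans ?_
    refine pow_le_pow_left₀ (by positivity) (div_le_self hBpos hb) 2
  have iS : ∀ i, Integrable ({z | 1 + distSq c z ≤ T}.indicator fun z => (w i z - A i z) ^ 2)
      (volume.restrict D) := fun i => ((hv i).memLp.integrable_sq).indicator hS
  obtain ⟨X, hX⟩ : ∃ X : Plane → ℝ, X = fun z =>
      ∑ i, {z | 1 + distSq c z ≤ T}.indicator (fun z => (w i z - A i z) ^ 2) z := ⟨_, rfl⟩
  have iX : Integrable X (volume.restrict D) := by
    rw [hX]; exact integrable_finsetSum _ fun i _ => iS i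
  have hXle : ∫ z in D, X z ≤ 3 / ρ ^ 2 * (1 + ρ ^ 2 / 3) ^ 2 * T ^ 2 *
      ∑ i, ∑ j, ∫ z in D, (G i j z - partialD j (A i) z) ^ 2 := by
    rw [hX, integral_finsetSum _ fun i _ => iS i, Finset.mul_sum]
    refine Finset.sum_le_sum fun i _ => ?_
    rw [integral_indicator hS]
    exact (hv i).integral_sq_le hρ hD hT
  have i1 : ∀ i j, Integrable (fun z => G i j z * (G i j z - partialD j (A i) z))
      (volume.restrict D) := fun i j => ((hw i).memLp_grad j).integrable_mul ((hv i).memLp_grad j)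
  have i2 : ∀ i j, Integrable (fun z => w j z * partialD j (A i) z * (w i z - A i z))
      (volume.restrict D) := fun i j => by
    obtain ⟨-, -, -, -, -, h4⟩ := (hv i).exists_approx hDb
    refine ((hdA4 i j).integrable_mul_mul (hw j).memLp h4).congr (Eventually.of_forall fun z => ?_)
    simp only
    ring
  have i3 : ∀ i j, Integrable (fun z => (G i j z - partialD j (A i) z) ^ 2)
      (volume.restrict D) := fun i j => ((hv i).memLp_grad j).integrable_sq
  have i4 : ∀ i j, Integrable (fun z => partialD j (A i) z ^ 2)
      (volume.restrict D) := fun i j => (hdA2 i j).integrable_sq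
  have hterm : ∀ i j, 3 / 4 * (∫ z in D, (G i j z - partialD j (A i) z) ^ 2) -
      2 * (∫ z in D, partialD j (A i) z ^ 2) - (K * lam + (K * lam) ^ 2) * (∫ z in D, X z) ≤
      (∫ z in D, G i j z * (G i j z - partialD j (A i) z)) +
      ∫ z in D, w j z * partialD j (A i) z * (w i z - A i z) := by
    intro i j
    rw [← integral_const_mul, ← integral_const_mul, ← integral_const_mul,
      ← integral_sub ((i3 i j).const_mul _) ((i4 i j).const_mul _),
      ← integral_sub (((i3 i j).const_mul _).sub' ((i4 i j).const_mul _)) (iX.const_mul _),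
      ← integral_add (i1 i j) (i2 i j)]
    refine integral_mono ((((i3 i j).const_mul _).sub' ((i4 i j).const_mul _)).sub'
      (iX.const_mul _)) ((i1 i j).add (i2 i j)) fun z => ?_
    by_cases hz : 1 + distSq c z ≤ T
    · have hXz : X z = (w 0 z - A 0 z) ^ 2 + (w 1 z - A 1 z) ^ 2 := by
        have hm : z ∈ {z | 1 + distSq c z ≤ T} := hz
        simp only [hX, Fin.sum_univ_two, Set.indicator_of_mem hm]
      have hle : ∀ k : Fin 2, (w k z - A k z) ^ 2 ≤ X z := by
        intro k
        rw [hXz]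
        fin_cases k <;> simp [sq_nonneg]
      exact energy_pointwise (hdAle i j z) (hA.bound j z) (hle i) (hle j)
    · have hXz : X z = 0 := by
        have hm : z ∉ {z | 1 + distSq c z ≤ T} := hz
        simp only [hX, Set.indicator_of_notMem hm, Finset.sum_const_zero]
      -- Beyond the cut-off region `∇A` vanishes, and the claim is only `3/4 G² ≤ G²`.
      simp only [hA.grad_outer i j z (not_le.1 hz), hXz]
      nlinarith [sq_nonneg (G i j z)]
  have hsum := Finset.sum_le_sum fun i (_ : i ∈ Finset.univ) =>
    Finset.sum_le_sum fun j (_ : j ∈ Finset.univ) => hterm i j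
  simp only [Finset.sum_sub_distrib, Finset.sum_add_distrib, ← Finset.mul_sum,
    Finset.sum_const, Finset.card_univ, Fintype.card_fin, nsmul_eq_mul] at hsum
  rw [hid] at hsum
  obtain ⟨E, hE⟩ : ∃ E, E = ∑ i, ∑ j, ∫ z in D, (G i j z - partialD j (A i) z) ^ 2 := ⟨_, rfl⟩
  obtain ⟨F, hF⟩ : ∃ F, F = ∑ i, ∑ j, ∫ z in D, partialD j (A i) z ^ 2 := ⟨_, rfl⟩
  rw [← hE] at hXle hsum
  rw [← hF] at hsum
  have hE0 : 0 ≤ E := by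
    rw [hE]
    exact Finset.sum_nonneg fun i _ => Finset.sum_nonneg fun j _ =>
      integral_nonneg fun z => sq_nonneg _
  have hEF : E ≤ 4 * F := by
    -- The factor `4` counts the pairs `(i, j)`, each of which contributes one `∫ X`.
    have h1 : 4 * (K * lam + (K * lam) ^ 2) * (∫ z in D, X z) ≤ 1 / 4 * E :=
      calc 4 * (K * lam + (K * lam) ^ 2) * (∫ z in D, X z)
          ≤ 4 * (K * lam + (K * lam) ^ 2) *
            (3 / ρ ^ 2 * (1 + ρ ^ 2 / 3) ^ 2 * T ^ 2 * E) := by gcongr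
        _ = 4 * (K * lam + (K * lam) ^ 2) *
            (3 / ρ ^ 2 * (1 + ρ ^ 2 / 3) ^ 2 * T ^ 2) * E := by ring
        _ ≤ 1 / 4 * E := by gcongr
    push_cast at hsum
    linarith
  have hFle : F ≤ 4 * ((K * lam / (Real.log T - Real.log (1 + M ^ 2))) ^ 2 *
      (Real.pi * Real.log T)) := by
    rw [hF]
    simp only [Fin.sum_univ_two]
    have h := hA.integral_sq_partialD_le hT hDo hDb
    linarith [h 0 0, h 0 1, h 1 0, h 1 1]
  have hG : ∫ z in D, ∑ i, ∑ j, G i j z ^ 2 ≤ 2 * E + 2 * F := by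
    have i5 : ∀ i j, Integrable (fun z => G i j z ^ 2) (volume.restrict D) := fun i j =>
      ((hw i).memLp_grad j).integrable_sq
    rw [integral_finsetSum _ fun i _ => integrable_finsetSum _ fun j _ => i5 i j, hE, hF,
      Finset.mul_sum, Finset.mul_sum, ← Finset.sum_add_distrib]
    refine Finset.sum_le_sum fun i _ => ?_
    rw [integral_finsetSum _ fun j _ => i5 i j, Finset.mul_sum, Finset.mul_sum,
      ← Finset.sum_add_distrib]
    refine Finset.sum_le_sum fun j _ => ?_
    rw [← integral_const_mul, ← integral_const_mul,
      ← integral_add ((i3 i j).const_mul _) ((i4 i j).const_mul _)]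
    refine integral_mono (i5 i j) (((i3 i j).const_mul _).add ((i4 i j).const_mul _)) fun z => ?_
    simp only
    nlinarith [sq_nonneg (G i j z - 2 * partialD j (A i) z)]
  linarith

/-! ### Subtracting test functions -/

theorem IsTestFunction.isW12 {D : Set Plane} {ψ : Plane → ℝ} (hψ : IsTestFunction D ψ) :
    IsW12 D ψ fun j => partialD j ψ := by
  refine ⟨hψ.memLp 2 _, fun j => hψ.memLp_partialD j 2 _, fun j φ hφ => ?_⟩
  have hprod := hψ.mul hφ.smooth
  have h := integral_partialD_eq_zero hprod.smooth hprod.compact j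
  have i1 : Integrable (fun z => ψ z * partialD j φ z) (volume.restrict D) :=
    (hψ.memLp 2 _).integrable_mul (hφ.memLp_partialD j 2 _)
  have i2 : Integrable (fun z => partialD j ψ z * φ z) (volume.restrict D) :=
    (hψ.memLp_partialD j 2 _).integrable_mul (hφ.memLp 2 _)
  rw [← setIntegral_eq_integral_of_support_subset (D := D)
    ((support_partialD_subset _ j).trans hprod.support_subset)] at h
  simp_rw [fun z => partialD_mul (hψ.differentiable z) (hφ.differentiable z) j] at h
  rw [integral_add i2 i1] at h
  linarith

/-- Used to exchange the unspecified extension `a` in the boundary condition for the cut-off field,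
`A - a` being a test function on `D`. The relations are required only on `D` because that test
function is cut off to zero outside. -/
theorem IsW12Zero.sub_testFunction {D : Set Plane} (hDo : IsOpen D) {f f' : Plane → ℝ}
    {g g' : Fin 2 → Plane → ℝ} (h : IsW12Zero D f g) {ψ : Plane → ℝ} (hψ : IsTestFunction D ψ)
    (hf : ∀ z ∈ D, f' z = f z - ψ z) (hg : ∀ j, ∀ z ∈ D, g' j z = g j z - partialD j ψ z) :
    IsW12Zero D f' g' := by
  have hfae : f' =ᵐ[volume.restrict D] fun z => f z - ψ z := by
    filter_upwards [ae_restrict_mem hDo.measurableSet] with z hz using hf z hz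
  have hgae : ∀ j, g' j =ᵐ[volume.restrict D] fun z => g j z - partialD j ψ z := fun j => by
    filter_upwards [ae_restrict_mem hDo.measurableSet] with z hz using hg j z hz
  refine ⟨⟨(memLp_congr_ae hfae).2 (h.memLp.sub (hψ.memLp 2 _)),
    fun j => (memLp_congr_ae (hgae j)).2 ((h.memLp_grad j).sub (hψ.memLp_partialD j 2 _)), ?_⟩, ?_⟩
  · intro j φ hφ
    have e1 : ∫ z in D, f' z * partialD j φ z =
        (∫ z in D, f z * partialD j φ z) - ∫ z in D, ψ z * partialD j φ z := by
      have a1 : Integrable (fun z => f z * partialD j φ z) (volume.restrict D) :=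
        h.memLp.integrable_mul (hφ.memLp_partialD j 2 _)
      have a2 : Integrable (fun z => ψ z * partialD j φ z) (volume.restrict D) :=
        (hψ.memLp 2 _).integrable_mul (hφ.memLp_partialD j 2 _)
      rw [← integral_sub a1 a2]
      refine integral_congr_ae ?_
      filter_upwards [hfae] with z hz
      rw [hz, sub_mul]
    have e2 : ∫ z in D, g' j z * φ z =
        (∫ z in D, g j z * φ z) - ∫ z in D, partialD j ψ z * φ z := by
      have a1 : Integrable (fun z => g j z * φ z) (volume.restrict D) :=
        (h.memLp_grad j).integrable_mul (hφ.memLp 2 _)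
      have a2 : Integrable (fun z => partialD j ψ z * φ z) (volume.restrict D) :=
        (hψ.memLp_partialD j 2 _).integrable_mul (hφ.memLp 2 _)
      rw [← integral_sub a1 a2]
      refine integral_congr_ae ?_
      filter_upwards [hgae j] with z hz
      rw [hz, sub_mul]
    rw [e1, e2, h.weak_partial j φ hφ, hψ.isW12.weak_partial j φ hφ]
    ring
  · obtain ⟨φ, hφ, hlim, hlimg⟩ := h.approx
    refine ⟨fun n z => φ n z - ψ z, fun n => (hφ n).sub hψ, hlim.congr fun n => ?_,
      fun j => (hlimg j).congr fun n => ?_⟩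
    · refine eLpNorm_congr_ae ?_
      filter_upwards [hfae] with z hz
      rw [hz]; ring
    · refine eLpNorm_congr_ae ?_
      filter_upwards [hgae j] with z hz
      rw [hz, partialD_sub ((hφ n).differentiable z) (hψ.differentiable z)]
      ring

/-- A smooth function vanishing near the boundary of a bounded open set `D` agrees on `D` with a
test function. -/
theorem isTestFunction_indicator {D : Set Plane} (hDo : IsOpen D) (hDb : Bornology.IsBounded D)
    {f : Plane → ℝ} (hf : ContDiff ℝ ∞ f) (hfr : ∀ z ∈ frontier D, ∀ᶠ y in 𝓝 z, f y = 0) :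
    IsTestFunction D (D.indicator f) := by
  have hin : ∀ z ∈ D, D.indicator f =ᶠ[𝓝 z] f := fun z hz => by
    filter_upwards [hDo.mem_nhds hz] with y hy using Set.indicator_of_mem hy f
  have hout : ∀ z, z ∉ D → D.indicator f =ᶠ[𝓝 z] fun _ => 0 := by
    intro z hz
    by_cases hc : z ∈ closure D
    · filter_upwards [hfr z ⟨hc, fun h => hz (interior_subset h)⟩] with y hy
      by_cases hyD : y ∈ D
      · rw [Set.indicator_of_mem hyD, hy]
      · exact Set.indicator_of_notMem hyD f
    · filter_upwards [isClosed_closure.isOpen_compl.mem_nhds hc] with y hy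
      exact Set.indicator_of_notMem (fun h => hy (subset_closure h)) f
  have hsub : tsupport (D.indicator f) ⊆ D := fun z hz => by
    by_contra hD
    exact (notMem_tsupport_iff_eventuallyEq.2 (hout z hD)) hz
  refine ⟨contDiff_iff_contDiffAt.2 fun z => ?_, ?_, hsub⟩
  · by_cases hz : z ∈ D
    · exact hf.contDiffAt.congr_of_eventuallyEq (hin z hz)
    · exact contDiffAt_const.congr_of_eventuallyEq (hout z hz)
  · exact Metric.isCompact_of_isClosed_isBounded (isClosed_tsupport _) (hDb.subset hsub)

theorem isOpen_invadingDomain (U : Set Plane) (R : ℝ) : IsOpen (invadingDomain U R) :=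
  isClosed_closure.isOpen_compl.inter Metric.isOpen_ball

theorem isBounded_invadingDomain (U : Set Plane) (R : ℝ) :
    Bornology.IsBounded (invadingDomain U R) :=
  Metric.isBounded_ball.subset Set.inter_subset_right

/-- The difference of a weak solution and a cut-off field lies in `W^{1,2}_0`. -/
theorem IsInvadingSolution.isW12Zero_sub {U : Set Plane} {R lam : ℝ} {w : Plane → Plane}
    {G : Plane → Matrix (Fin 2) (Fin 2) ℝ} {p : Plane → ℝ} (h : IsInvadingSolution U R lam w G p)
    {K : ℝ} {c : Plane} {M T : ℝ} {A : Fin 2 → Plane → ℝ} (hA : IsCutoffField K c M T lam A)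
    (hM : closure U ⊆ Metric.ball c M) (hT : 1 ≤ T) (hR : ‖c‖ + T < R) (i : Fin 2) :
    IsW12Zero (invadingDomain U R) (fun z => w z i - A i z)
      fun j z => G z i j - partialD j (A i) z := by
  obtain ⟨a, ha, ha0, ha1, hz⟩ := h.boundary
  have hDo := isOpen_invadingDomain U R
  have hai : ContDiff ℝ ∞ fun z => a z i := (contDiff_coord i).comp ha
  have hfr : ∀ z ∈ frontier (invadingDomain U R), ∀ᶠ y in 𝓝 z, A i y - a y i = 0 := by
    intro z hz
    rcases frontier_inter_subset _ _ hz with ⟨h1, -⟩ | ⟨-, h1⟩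
    · have h2 : z ∈ Metric.ball c M := by
        refine hM ?_
        have : z ∈ frontier (closure U) := by rwa [← frontier_compl]
        exact isClosed_closure.frontier_subset this
      filter_upwards [Metric.isOpen_ball.mem_nhds h2, (eventually_nhdsSet_iff_forall.1 ha0) z h1]
        with y hy hy'
      rw [hA.inner i y hy, hy']
      simp
    · have h2 : z ∈ Metric.sphere (0 : Plane) R := Metric.frontier_ball_subset_sphere h1
      -- On the outer circle `|z - c| ≥ R - ‖c‖ > T ≥ 1`, hence `|z - c|² > T`.
      have h3 : T < 1 + distSq c z := by
        have h4 : ‖z‖ = R := by simpa using h2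
        have h5 : ‖z‖ ≤ dist z c + ‖c‖ := by
          rw [dist_eq_norm]
          simpa using norm_add_le (z - c) c
        rw [distSq_eq]
        nlinarith
      have hopen : IsOpen {z | T < 1 + distSq c z} :=
        isOpen_lt continuous_const (continuous_const.add (contDiff_distSq c).continuous)
      filter_upwards [hopen.mem_nhds h3, (eventually_nhdsSet_iff_forall.1 ha1) z h2] with y hy hy'
      rw [hA.outer i y hy, hy']
      fin_cases i <;> simp
  have hψ := isTestFunction_indicator hDo (isBounded_invadingDomain U R)
    ((hA.smooth i).sub hai) hfr
  refine (hz i).sub_testFunction hDo hψ (fun z hz => ?_) fun j z hz => ?_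
  · rw [Set.indicator_of_mem hz]
    ring
  · have e : (invadingDomain U R).indicator (fun z => A i z - a z i) =ᶠ[𝓝 z]
        fun z => A i z - a z i := by
      filter_upwards [hDo.mem_nhds hz] with y hy using Set.indicator_of_mem hy _
    rw [partialD_congr e, partialD_sub ((hA.smooth i).differentiable (by simp) z)
      (hai.differentiable (by simp) z)]
    ring

theorem lemma4p1 (α : ℝ≥0) (hα : 0 < α) (hα' : α ≤ 1)
    (U : Set Plane) (hU : IsOpen U) (hUc : IsConnected U) (hUb : Bornology.IsBounded U)
    (hUα : HasC2HolderBoundary α U) :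
    ∃ lam₀ : ℝ, 0 < lam₀ ∧ lam₀ < 1 ∧ ∃ C : ℝ, 0 < C ∧
      ∀ lam : ℝ, 0 < lam → lam ≤ lam₀ →
      ∀ R : ℕ → ℝ, Tendsto R atTop atTop →
      ∃ k₀ : ℕ, ∀ k : ℕ, k₀ ≤ k →
      ∀ (w : Plane → Plane) (G : Plane → Matrix (Fin 2) (Fin 2) ℝ) (p : Plane → ℝ),
        IsInvadingSolution U (R k) lam w G p →
        dirichletIntegral (invadingDomain U (R k)) G ≤ C * lam ^ 2 / |Real.log lam| := by
  -- The disc of radius `ρ` about `c` lies in `U`, so the flow region stays at distance at least `ρ`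
  -- from `c`, as the Hardy inequality requires.
  obtain ⟨c, hc⟩ := hUc.nonempty
  obtain ⟨ρ, hρ, hρU⟩ := Metric.isOpen_iff.1 hU c hc
  obtain ⟨M, hM, hMU⟩ : ∃ M, 0 < M ∧ closure U ⊆ Metric.ball c M := by
    obtain ⟨M, hM⟩ := hUb.closure.subset_ball c
    refine ⟨max M 1, by positivity, hM.trans (Metric.ball_subset_ball (le_max_left _ _))⟩
  obtain ⟨K, hK, hcut⟩ := exists_isCutoffField
  obtain ⟨a, ha⟩ : ∃ a, a = Real.log (1 + M ^ 2) := ⟨_, rfl⟩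
  have ha0 : 0 ≤ a := by
    rw [ha]
    exact Real.log_nonneg (by nlinarith [sq_nonneg M])
  obtain ⟨κ, hκ⟩ : ∃ κ, κ = 3 / ρ ^ 2 * (1 + ρ ^ 2 / 3) ^ 2 := ⟨_, rfl⟩
  have hκ0 : 0 < κ := by rw [hκ]; positivity
  -- The first bound gives `|log lam| ≥ 8 (a + 1)`, so that `log T - a = |log lam| / 4 - a` is at
  -- least `|log lam| / 8` and at least `1`. The second makes `√lam` small enough for the absorption
  -- in `energy_estimate`. The constant is `640 = 40 · 8² / 4`.
  refine ⟨min (Real.exp (-(8 * (a + 1)))) ((1 / (16 * (K + K ^ 2) * κ)) ^ 2), by positivity,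
    min_lt_of_left_lt (Real.exp_lt_one_iff.2 (by linarith)), 640 * Real.pi * K ^ 2, by positivity, ?_⟩
  intro lam hlam hle R hR
  have hle1 := hle.trans (min_le_left _ _)
  have hle2 := hle.trans (min_le_right _ _)
  obtain ⟨L, hL⟩ : ∃ L, L = -Real.log lam := ⟨_, rfl⟩
  have hL8 : 8 * (a + 1) ≤ L := by
    have := Real.log_le_log hlam hle1
    rw [Real.log_exp] at this
    linarith
  have hL0 : 0 < L := by linarith
  have hlam1 : lam ≤ 1 := hle1.trans (Real.exp_le_one_iff.2 (by linarith))
  obtain ⟨s, hs⟩ : ∃ s, s = √lam := ⟨_, rfl⟩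
  have hs0 : 0 < s := by rw [hs]; positivity
  have hs2 : s ^ 2 = lam := by rw [hs, Real.sq_sqrt hlam.le]
  have hsmall : s * (16 * (K + K ^ 2) * κ) ≤ 1 := by
    rw [← le_div_iff₀ (by positivity)]
    exact hs ▸ Real.sqrt_le_iff.2 ⟨by positivity, hle2⟩
  -- `T = lam^(-1/4)`: then `lam T² = √lam`, while `log T = |log lam| / 4`.
  obtain ⟨T, hT⟩ : ∃ T, T = (√s)⁻¹ := ⟨_, rfl⟩
  have hT0 : 0 < T := by rw [hT]; positivity
  have hT2 : T ^ 2 = s⁻¹ := by rw [hT, inv_pow, Real.sq_sqrt hs0.le]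
  have hlogT : Real.log T = L / 4 := by
    rw [hT, Real.log_inv, Real.log_sqrt hs0.le, hs, Real.log_sqrt hlam.le, hL]
    ring
  have hT1 : 1 ≤ T := by
    by_contra hlt
    have := Real.log_neg hT0 (not_le.1 hlt)
    linarith
  have hb : L / 8 ≤ Real.log T - Real.log (1 + M ^ 2) := by
    rw [hlogT, ← ha]; linarith
  have hb1 : 1 ≤ Real.log T - Real.log (1 + M ^ 2) := by
    rw [hlogT, ← ha]; linarith
  obtain ⟨A, hA⟩ := hcut c M T lam hM hT0 hlam.le hb1
  obtain ⟨k₀, hk₀⟩ := eventually_atTop.1 (hR.eventually_gt_atTop (‖c‖ + T))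
  refine ⟨k₀, fun k hk w G p hsol => ?_⟩
  have hD : ∀ z ∈ invadingDomain U (R k), ρ ≤ dist z c := fun z hz => by
    by_contra hlt
    exact hz.1 (subset_closure (hρU (Metric.mem_ball.2 (not_le.1 hlt))))
  have hsm : 4 * (K * lam + (K * lam) ^ 2) *
      (3 / ρ ^ 2 * (1 + ρ ^ 2 / 3) ^ 2 * T ^ 2) ≤ 1 / 4 := by
    rw [← hκ, hT2]
    have h1 : K * lam + (K * lam) ^ 2 ≤ (K + K ^ 2) * lam := by
      have : K ^ 2 * (lam * lam) ≤ K ^ 2 * (lam * 1) := by gcongr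
      nlinarith
    calc 4 * (K * lam + (K * lam) ^ 2) * (κ * s⁻¹)
        ≤ 4 * ((K + K ^ 2) * lam) * (κ * s⁻¹) := by gcongr
      _ = s * (16 * (K + K ^ 2) * κ) / 4 := by
          rw [← hs2]
          field_simp
          ring
      _ ≤ 1 / 4 := by gcongr
  have hfinal := energy_estimate (isOpen_invadingDomain U (R k)) (isBounded_invadingDomain U (R k))
    hsol.velocity hsol.pressure hsol.divergence_free hsol.momentum hA hK.le hlam.le hT1 hb1 hρ hD
    hsm fun i => hsol.isW12Zero_sub hA hMU hT1 (hk₀ k hk) i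
  unfold dirichletIntegral
  refine hfinal.trans ?_
  have habs : |Real.log lam| = L := by
    rw [abs_of_neg (by linarith), hL]
  rw [habs, hlogT]
  calc 40 * ((K * lam / (L / 4 - Real.log (1 + M ^ 2))) ^ 2 * (Real.pi * (L / 4)))
      ≤ 40 * ((K * lam / (L / 8)) ^ 2 * (Real.pi * (L / 4))) := by
        rw [hlogT] at hb
        have := Real.pi_pos
        have : 0 < L / 4 - Real.log (1 + M ^ 2) := by linarith
        gcongr
    _ = 640 * Real.pi * K ^ 2 * lam ^ 2 / L := by
        field_simp
        ring
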